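/- **Crystallographic arrangements.** Let $r\ge 1$ and $V=\mathbb R^r$. A *simplicial arrangement* in $V$ is a finite set $\mathcal A$ of linear hyperplanes such that every *chamber*, i.e. every connected component of $V\setminus\bigcup_{H\in\mathcal A}H$, is an open simplicial cone $\{\sum_i a_iv_i\mid a_i>0\}$ for some basis $v_1,\dots,v_r$ of $V$. Let $R\subseteq V^*$ be a finite set with $\mathcal A=\{\ker\alpha\mid\alpha\in R\}$ and $\mathbb R\alpha\cap R=\{\pm\alpha\}$ for all $\alpha\in R$. The *walls* of a chamber $K$ are the $H\in\mathcal A$ with $\dim(H\cap\overline K)=r-1$, and $B^K$ is the set of all $\alpha\in R$ such that $\ker\alpha$ is a wall of $K$ and $\alpha\ge 0$ on $K$; it is a basis of $V^*$. The pair $(\mathcal A,R)$ is a *crystallographic arrangement* of rank $r$ if $R\subseteq\sum_{\alpha\in B^K}\mathbb Z\alpha$ for every chamber $K$. Two crystallographic arrangements $(\mathcal A,R)$, $(\mathcal A',R')$ in $V$ are *equivalent* if $\psi(R)=R'$ for some $\psi\in\mathrm{Aut}(V^*)$; arrangements of different ranks are not equivalent. **Cartan schemes.** A *Cartan scheme*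 $\mathcal C=(I,A,(\rho_i)_{i\in I},(C^a)_{a\in A})$ consists of a non-empty finite set $I$, a non-empty set $A$, maps $\rho_i:A\to A$ with $\rho_i^2=\mathrm{id}$, and generalized Cartan matrices $C^a=(c^a_{ij})\in\mathbb Z^{I\times I}$ (that is, $c^a_{ii}=2$, $c^a_{ij}\le 0$ for $i\ne j$, and $c^a_{ij}=0\Rightarrow c^a_{ji}=0$) with $c^a_{ij}=c^{\rho_i(a)}_{ij}$. Let $(\alpha_i)_{i\in I}$ be the standard basis of $\mathbb Z^I$ and let $\sigma_i^a\in\mathrm{Aut}(\mathbb Z^I)$, $\sigma_i^a(\alpha_j)=\alpha_j-c^a_{ij}\alpha_i$. In the *Weyl groupoid* the objects are the elements of $A$, and $\mathrm{Hom}(a,b)$ is the set of all automorphisms of $\mathbb Z^I$ that are compositions of maps $\sigma_i^c$, each regarded as a morphism from $c$ to $\rho_i(c)$, leading from $a$ to $b$. The scheme is *connected* if $\mathrm{Hom}(a,b)\neq\emptyset$ for all $a,b$, and *simply connected* if $\mathrm{Hom}(a,a)=\{\mathrm{id}\}$ for all $a$. The *real roots* at $a$ are the elements $w(\alpha_j)$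 with $b\in A$, $w\in\mathrm{Hom}(b,a)$, $j\in I$. Subsets $R^a\subseteq\mathbb Z^I$ ($a\in A$) form a *root system of type $\mathcal C$* if for all $a\in A$, $i,j\in I$: (R1) $R^a=R^a_+\cup-R^a_+$ with $R^a_+=R^a\cap\mathbb N_0^I$; (R2) $R^a\cap\mathbb Z\alpha_i=\{\pm\alpha_i\}$; (R3) $\sigma_i^a(R^a)=R^{\rho_i(a)}$; (R4) if $i\ne j$ and $m=|R^a\cap(\mathbb N_0\alpha_i+\mathbb N_0\alpha_j)|$ is finite, then $(\rho_i\rho_j)^m(a)=a$. It is *finite* if all $R^a$ are finite. Cartan schemes $\mathcal C,\mathcal C'$ are *equivalent* if there are bijections $\varphi_0:I\to I'$, $\varphi_1:A\to A'$ with $\varphi_1(\rho_i(a))=\rho'_{\varphi_0(i)}(\varphi_1(a))$ and $c'^{\,\varphi_1(a)}_{\varphi_0(i)\varphi_0(j)}=c^a_{ij}$ for all $i,j,a$. **The scheme $\mathcal C(\mathcal A,R,K_0)$.** Let $(\mathcal A,R)$ be a crystallographic arrangement of rank $r$, $K_0$ a chamber, and $B^{K_0}=\{\alpha_1,\dots,\alpha_r\}$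 an ordering. For a chamber $K$ and $\alpha\in B^K$ there is a unique chamber $K'\ne K$ such that $\overline K\cap\overline{K'}$ spans $\ker\alpha$ (the chamber *adjacent* to $K$ along $\ker\alpha$), and there are unique $c_\beta\in\mathbb N_0$ ($\beta\in B^K\setminus\{\alpha\}$) such that $\alpha\mapsto-\alpha$, $\beta\mapsto\beta+c_\beta\alpha$ is a bijection $B^K\to B^{K'}$; extend it linearly to $V^*$. Starting with $K_0$, a finite (possibly empty) sequence $a=(\mu_1,\dots,\mu_m)$ in $I=\{1,\dots,r\}$ defines chambers $K_0,\dots,K_m$ and automorphisms $\pi_0=\mathrm{id},\dots,\pi_m=:\pi(a)$ of $V^*$: $K_k$ is adjacent to $K_{k-1}$ along $\ker\pi_{k-1}(\alpha_{\mu_k})$, and $\pi_k$ is $\pi_{k-1}$ followed by the linear extension of the bijection $B^{K_{k-1}}\to B^{K_k}$. Let $A$ be the set of classes of sequences under $a\sim b\Leftrightarrow\pi(a)=\pi(b)$, let $\rho_i$ map the class of $a$ to the class of the sequence $a.i$ ($a$ extended by $i$), and let $C^a=(c^a_{ij})$ be given by $\pi(a.i)(\alpha_j)=\pi(a)(\alpha_j)-c^a_{ij}\,\pi(a)(\alpha_i)$.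 Then $\mathcal C(\mathcal A,R,K_0)=(I,A,(\rho_i),(C^a))$. **Theorem.** Let $\mathfrak A$ be the class of all crystallographic arrangements (of all ranks $r\geq 1$), and let $\mathfrak C$ be the class of all connected simply connected Cartan schemes for which the real roots form a finite root system. Every crystallographic arrangement has a chamber, each $B^K$ is a basis of $V^*$, the scheme $\mathcal C(\mathcal A,R,K)$ lies in $\mathfrak C$ for every chamber $K$ and every ordering of $B^K$, its equivalence class depends only on the equivalence class of $(\mathcal A,R)$, and the map $$\Lambda:\mathfrak A/_{\cong}\to\mathfrak C/_{\cong},\qquad \overline{(\mathcal A,R)}\mapsto\overline{\mathcal C(\mathcal A,R,K)}\quad(K\text{ any chamber})$$ is a bijection. Moreover, $R$ is the set of real roots: for each object of $\mathcal C(\mathcal A,R,K)$, represented by a sequence $a$, the map $\mathbb Z^r\to V^*$, $x\mapsto\sum_jx_j\,\pi(a)(\alpha_j)$ maps the real roots at this object onto $R$. -/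

import Mathlib

open Module

universe u v u' v'

noncomputable section

/-! ### Simplicial and crystallographic arrangements in `ℝ ^ r` -/

namespace Arrangement

variable {r : ℕ}

/-- The complement of the union of the hyperplanes. -/
def complement (𝒜 : Set (Submodule ℝ (Fin r → ℝ))) : Set (Fin r → ℝ) :=
  {v | ∀ H ∈ 𝒜, v ∉ H}

/-- The chambers: the connected components of the complement. -/
def chambers (𝒜 : Set (Submodule ℝ (Fin r → ℝ))) : Set (Set (Fin r → ℝ)) :=
  {K | ∃ v ∈ complement 𝒜, K = connectedComponentIn (complement 𝒜) v}

/-- Open simplicial cones: all positive linear combinations of a basis. -/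
def IsOpenSimplicialCone (K : Set (Fin r → ℝ)) : Prop :=
  ∃ b : Basis (Fin r) ℝ (Fin r → ℝ),
    K = {v | ∃ a : Fin r → ℝ, (∀ i, 0 < a i) ∧ v = ∑ i, a i • b i}

/-- A simplicial arrangement: finitely many linear hyperplanes all of whose chambers are open
simplicial cones. -/
structure IsSimplicial (𝒜 : Set (Submodule ℝ (Fin r → ℝ))) : Prop where
  finite : 𝒜.Finite
  hyperplane : ∀ H ∈ 𝒜, finrank ℝ H + 1 = r
  cone : ∀ K ∈ chambers 𝒜, IsOpenSimplicialCone K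

/-- The walls of `K`: the hyperplanes `H` with `dim (H ∩ closure K) = r - 1`. (For a chamber `K`,
the set `H ∩ closure K` is a convex cone containing `0`, so that its dimension is the dimension of
its linear span.) -/
def walls (𝒜 : Set (Submodule ℝ (Fin r → ℝ))) (K : Set (Fin r → ℝ)) :
    Set (Submodule ℝ (Fin r → ℝ)) :=
  {H | H ∈ 𝒜 ∧ finrank ℝ (Submodule.span ℝ ((H : Set (Fin r → ℝ)) ∩ closure K)) + 1 = r}

/-- The set `B^K` of the elements of `R` that are normal to the walls of `K` and point to the
inside. -/
def base (𝒜 : Set (Submodule ℝ (Fin r → ℝ))) (R : Set (Dual ℝ (Fin r → ℝ)))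
    (K : Set (Fin r → ℝ)) : Set (Dual ℝ (Fin r → ℝ)) :=
  {α | α ∈ R ∧ LinearMap.ker α ∈ walls 𝒜 K ∧ ∀ v ∈ K, 0 ≤ α v}

/-- Two chambers are adjacent along the hyperplane `H` if they are distinct and have a common facet
spanning `H`. -/
def Adjacent (𝒜 : Set (Submodule ℝ (Fin r → ℝ))) (H : Submodule ℝ (Fin r → ℝ))
    (K K' : Set (Fin r → ℝ)) : Prop :=
  K ∈ chambers 𝒜 ∧ K' ∈ chambers 𝒜 ∧ K ≠ K' ∧ Submodule.span ℝ (closure K ∩ closure K') = H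

end Arrangement

/-- Crystallographic arrangements `(𝒜, R)`, of arbitrary rank `r ≥ 1`. -/
structure CrystallographicArrangement where
  /-- the dimension of the ambient space -/
  r : ℕ
  r_pos : 0 < r
  /-- the hyperplanes -/
  𝒜 : Set (Submodule ℝ (Fin r → ℝ))
  /-- the normal vectors -/
  R : Set (Dual ℝ (Fin r → ℝ))
  simplicial : Arrangement.IsSimplicial 𝒜
  finite_R : R.Finite
  𝒜_eq : 𝒜 = {H | ∃ α ∈ R, H = LinearMap.ker α}
  reduced : ∀ α ∈ R, {β | β ∈ R ∧ ∃ t : ℝ, β = t • α} = {α, -α}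
  integral : ∀ K ∈ Arrangement.chambers 𝒜,
    R ⊆ (Submodule.span ℤ (Arrangement.base 𝒜 R K) : Set (Dual ℝ (Fin r → ℝ)))

namespace CrystallographicArrangement

/-- `(𝒜, R) ≅ (𝒜', R')`: some linear isomorphism of the dual spaces maps `R` onto `R'`. (It forces
the ranks to be equal.) -/
def Equivalent (X Y : CrystallographicArrangement) : Prop :=
  ∃ ψ : Dual ℝ (Fin X.r → ℝ) ≃ₗ[ℝ] Dual ℝ (Fin Y.r → ℝ), ψ '' X.R = Y.R

instance setoid : Setoid CrystallographicArrangement where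
  r := Equivalent
  iseqv :=
    { refl := fun X => ⟨LinearEquiv.refl ℝ _, Set.image_id _⟩
      symm := by
        rintro X Y ⟨ψ, h⟩
        refine ⟨ψ.symm, ?_⟩
        rw [← h, ← Set.image_comp]
        simp
      trans := by
        rintro X Y Z ⟨ψ, h⟩ ⟨χ, h'⟩
        refine ⟨ψ.trans χ, ?_⟩
        rw [← h', ← h, ← Set.image_comp]
        rfl }

end CrystallographicArrangement

/-! ### Cartan schemes, Weyl groupoids and real roots -/

/-- A quadruple `(I, A, (ρ_i), (C^a))` consisting of a finite set, a set, self-maps of `A` and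
integral matrices. -/
structure CartanQuadruple where
  /-- the labels -/
  I : Type u
  /-- the objects -/
  A : Type v
  [fintypeI : Fintype I]
  [decEqI : DecidableEq I]
  /-- the maps between the objects -/
  ρ : I → A → A
  /-- the matrices -/
  C : A → Matrix I I ℤ

namespace CartanQuadruple

attribute [instance] fintypeI decEqI

/-- Generalized Cartan matrices. -/
structure IsGeneralizedCartanMatrix {I : Type u} (C : Matrix I I ℤ) : Prop where
  diag : ∀ i, C i i = 2
  nonpos : ∀ j k, j ≠ k → C j k ≤ 0
  zero : ∀ i j, C i j = 0 → C j i = 0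

/-- Cartan schemes. -/
structure IsCartanScheme (S : CartanQuadruple.{u, v}) : Prop where
  nonempty_I : Nonempty S.I
  nonempty_A : Nonempty S.A
  cartan : ∀ a, IsGeneralizedCartanMatrix (S.C a)
  ρ_ρ : ∀ i a, S.ρ i (S.ρ i a) = a
  C_ρ : ∀ i j a, S.C a i j = S.C (S.ρ i a) i j

/-- The standard basis `α_i` of `ℤ ^ I`. -/
def simpleRoot (S : CartanQuadruple.{u, v}) (i : S.I) : S.I → ℤ := Pi.single i 1

/-- The map `σ_i^a` of `ℤ ^ I` with `σ_i^a (α_j) = α_j - c_{ij}^a α_i`. -/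
def s (S : CartanQuadruple.{u, v}) (a : S.A) (i : S.I) : (S.I → ℤ) →ₗ[ℤ] (S.I → ℤ) :=
  (Pi.basisFun ℤ S.I).constr ℤ fun j => S.simpleRoot j - S.C a i j • S.simpleRoot i

/-- `S.IsMorphism a b w`: `w ∈ Hom (a, b)` in the Weyl groupoid, that is, `w` is a composition
of maps `σ_i^c`, each regarded as a morphism from `c` to `ρ_i c`, leading from `a` to `b`. -/
inductive IsMorphism (S : CartanQuadruple.{u, v}) (a : S.A) :
    S.A → ((S.I → ℤ) →ₗ[ℤ] (S.I → ℤ)) → Prop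
  | id : IsMorphism S a a LinearMap.id
  | comp (b : S.A) (w : (S.I → ℤ) →ₗ[ℤ] (S.I → ℤ)) (i : S.I) (h : IsMorphism S a b w) :
      IsMorphism S a (S.ρ i b) (S.s b i ∘ₗ w)

/-- The Weyl groupoid is connected. -/
def IsConnected (S : CartanQuadruple.{u, v}) : Prop :=
  ∀ a b, ∃ w, S.IsMorphism a b w

/-- `Hom (a, a) = {id_a}` for every object `a`. -/
def IsSimplyConnected (S : CartanQuadruple.{u, v}) : Prop :=
  ∀ a w, S.IsMorphism a a w → w = LinearMap.id

/-- The real roots at `a`. -/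
def realRoots (S : CartanQuadruple.{u, v}) (a : S.A) : Set (S.I → ℤ) :=
  {x | ∃ b w j, S.IsMorphism b a w ∧ x = w (S.simpleRoot j)}

/-- Root systems of type `S`. -/
structure IsRootSystem (S : CartanQuadruple.{u, v}) (R : S.A → Set (S.I → ℤ)) : Prop where
  R1 : ∀ a, R a = {x | x ∈ R a ∧ ∀ k, 0 ≤ x k} ∪ {x | -x ∈ R a ∧ ∀ k, 0 ≤ (-x) k}
  R2 : ∀ a i, {x | x ∈ R a ∧ ∃ t : ℤ, x = t • S.simpleRoot i} =
    {S.simpleRoot i, -S.simpleRoot i}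
  R3 : ∀ a i, S.s a i '' R a = R (S.ρ i a)
  R4 : ∀ a i j, i ≠ j →
    {x | x ∈ R a ∧ ∃ p q : ℕ, x = p • S.simpleRoot i + q • S.simpleRoot j}.Finite →
    (S.ρ i ∘ S.ρ j)^[{x | x ∈ R a ∧
      ∃ p q : ℕ, x = p • S.simpleRoot i + q • S.simpleRoot j}.ncard] a = a

/-- Connected simply connected Cartan schemes for which the real roots form a finite root
system. -/
structure IsFiniteType (S : CartanQuadruple.{u, v}) : Prop where
  scheme : S.IsCartanScheme
  connected : S.IsConnected
  simplyConnected : S.IsSimplyConnected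
  rootSystem : S.IsRootSystem S.realRoots
  finite : ∀ a, (S.realRoots a).Finite

/-- Equivalence of Cartan schemes. -/
def Equivalent (S : CartanQuadruple.{u, v}) (T : CartanQuadruple.{u', v'}) : Prop :=
  ∃ (φ₀ : S.I ≃ T.I) (φ₁ : S.A ≃ T.A),
    (∀ i a, φ₁ (S.ρ i a) = T.ρ (φ₀ i) (φ₁ a)) ∧
    ∀ i j a, T.C (φ₁ a) (φ₀ i) (φ₀ j) = S.C a i j

end CartanQuadruple

/-- The class of all connected simply connected Cartan schemes for which the real roots form a
finite root system. -/
def FiniteTypeScheme : Type (max (u + 1) (v + 1)) :=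
  {S : CartanQuadruple.{u, v} // S.IsFiniteType}

instance FiniteTypeScheme.setoid : Setoid FiniteTypeScheme.{u, v} where
  r S T := S.1.Equivalent T.1
  iseqv :=
    { refl := fun S => ⟨Equiv.refl _, Equiv.refl _, fun _ _ => rfl, fun _ _ _ => rfl⟩
      symm := by
        rintro S T ⟨f, g, h, h'⟩
        refine ⟨f.symm, g.symm, fun i a => ?_, fun i j a => ?_⟩
        · rw [Equiv.symm_apply_eq, h]; simp
        · rw [← h']; simp
      trans := by
        rintro S T U ⟨f, g, h, h'⟩ ⟨f₂, g₂, k, k'⟩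
        refine ⟨f.trans f₂, g.trans g₂, fun i a => ?_, fun i j a => ?_⟩
        · simp [h, k]
        · simp [h', k'] }

/-! ### The Cartan scheme of a crystallographic arrangement -/

/-- For a basis `b` and natural numbers `c`, the linear involution
`b i ↦ - b i`, `b j ↦ b j + c j • b i` for `j ≠ i`. -/
def basisReflection {r : ℕ} {W : Type*} [AddCommGroup W] [Module ℝ W]
    (b : Basis (Fin r) ℝ W) (i : Fin r) (c : Fin r → ℕ) : W ≃ₗ[ℝ] W :=
  have h : (b.constr ℝ fun j => if j = i then -b i else b j + c j • b i) ∘ₗ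
      (b.constr ℝ fun j => if j = i then -b i else b j + c j • b i) = LinearMap.id := by
    refine b.ext fun j => ?_
    rw [LinearMap.comp_apply, Basis.constr_basis]
    by_cases hj : j = i
    · rw [if_pos hj, map_neg, Basis.constr_basis, if_pos rfl, neg_neg, hj, LinearMap.id_apply]
    · rw [if_neg hj, map_add, map_nsmul, Basis.constr_basis, Basis.constr_basis, if_pos rfl,
        if_neg hj, LinearMap.id_apply, smul_neg, add_neg_cancel_right]
  LinearEquiv.ofLinearMap _ _ h h

namespace CrystallographicArrangement

variable (X : CrystallographicArrangement)

/-- An ordering `B^K = {α_1, …, α_r}` of the basis attached to the chamber `K`. -/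
def IsOrdering (K : Set (Fin X.r → ℝ)) (α : Basis (Fin X.r) ℝ (Dual ℝ (Fin X.r → ℝ))) : Prop :=
  Set.range α = Arrangement.base X.𝒜 X.R K

/-- The unique chamber adjacent to the chamber `K` along its wall `H`. -/
def nextChamber (K : Set (Fin X.r → ℝ)) (H : Submodule ℝ (Fin X.r → ℝ)) : Set (Fin X.r → ℝ) :=
  Classical.epsilon fun K' => Arrangement.Adjacent X.𝒜 H K K'

/-- For an ordering `b` of `B^K` and the chamber `K'` adjacent to `K` along the kernel of `b i`, the
natural numbers `c j` (unique for `j ≠ i`) such that `b i ↦ - b i`,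
`b j ↦ b j + c j • b i` is a bijection from `B^K` to `B^K'`. -/
def coeff (K : Set (Fin X.r → ℝ)) (b : Basis (Fin X.r) ℝ (Dual ℝ (Fin X.r → ℝ)))
    (i : Fin X.r) : Fin X.r → ℕ :=
  Classical.epsilon fun c => Set.BijOn (basisReflection b i c) (Set.range b)
    (Arrangement.base X.𝒜 X.R (X.nextChamber K (LinearMap.ker (b i))))

/-- One step of the construction. A state is a chamber `K`, with an automorphism `π` of `V*` that
maps the fixed basis `α` of the starting chamber to an ordering of `B^K`; the step
in direction `i` passes to the chamber adjacent to `K` along the kernel of `π (α_i)`, and composes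
`π` with the reflection `σ_i^K`. -/
def step (α : Basis (Fin X.r) ℝ (Dual ℝ (Fin X.r → ℝ)))
    (x : Set (Fin X.r → ℝ) × (Dual ℝ (Fin X.r → ℝ) ≃ₗ[ℝ] Dual ℝ (Fin X.r → ℝ))) (i : Fin X.r) :
    Set (Fin X.r → ℝ) × (Dual ℝ (Fin X.r → ℝ) ≃ₗ[ℝ] Dual ℝ (Fin X.r → ℝ)) :=
  (X.nextChamber x.1 (LinearMap.ker (x.2 (α i))),
    x.2.trans (basisReflection (α.map x.2) i (X.coeff x.1 (α.map x.2) i)))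

/-- The chamber `K_a` reached from `K₀` along the sequence `a = (μ_1, …, μ_m)`, and the
automorphism `π(a) = σ_{μ_m} ⋯ σ_{μ_1}` of `V*`. -/
def walk (K₀ : Set (Fin X.r → ℝ)) (α : Basis (Fin X.r) ℝ (Dual ℝ (Fin X.r → ℝ)))
    (a : List (Fin X.r)) :
    Set (Fin X.r → ℝ) × (Dual ℝ (Fin X.r → ℝ) ≃ₗ[ℝ] Dual ℝ (Fin X.r → ℝ)) :=
  a.foldl (X.step α) (K₀, LinearEquiv.refl ℝ _)

/-- Sequences `a`, `b` are identified if `π(a) = π(b)`. -/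
def pathSetoid (K₀ : Set (Fin X.r → ℝ)) (α : Basis (Fin X.r) ℝ (Dual ℝ (Fin X.r → ℝ))) :
    Setoid (List (Fin X.r)) :=
  Setoid.ker fun a => (X.walk K₀ α a).2

/-- The ordered basis `φ_a(α_1), …, φ_a(α_r)` of the chamber `K_a`. -/
def pathBasis (K₀ : Set (Fin X.r → ℝ)) (α : Basis (Fin X.r) ℝ (Dual ℝ (Fin X.r → ℝ)))
    (a : List (Fin X.r)) : Basis (Fin X.r) ℝ (Dual ℝ (Fin X.r → ℝ)) :=
  α.map (X.walk K₀ α a).2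

/-- The integers `c_{ij}` with `φ_{a.i}(α_j) = φ_a(α_j) - c_{ij} φ_a(α_i)`. -/
def pathMatrix (K₀ : Set (Fin X.r → ℝ)) (α : Basis (Fin X.r) ℝ (Dual ℝ (Fin X.r → ℝ)))
    (a : List (Fin X.r)) : Matrix (Fin X.r) (Fin X.r) ℤ :=
  fun i j => if j = i then 2 else -(X.coeff (X.walk K₀ α a).1 (X.pathBasis K₀ α a) i j : ℤ)

/-- The Cartan scheme `C(𝒜, R, K₀)`, for an ordering `α` of `B^{K₀}`. The objects are the classes of
sequences, `ρ_i` maps the class of `a` to the class of `a.i`, and the matrix at the class of `a`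
is `pathMatrix` at `a`; both are independent of the representative `a`. -/
def cartanScheme (K₀ : Set (Fin X.r → ℝ)) (α : Basis (Fin X.r) ℝ (Dual ℝ (Fin X.r → ℝ))) :
    CartanQuadruple.{0, 0} where
  I := Fin X.r
  A := Quotient (X.pathSetoid K₀ α)
  ρ i a := Quotient.mk _ (a.out ++ [i])
  C a := X.pathMatrix K₀ α a.out

end CrystallographicArrangement

end

/-! Chambers of a crystallographic arrangement correspond to *root bases*: bases `b` of `V*`
contained in `R` such that the coordinates of every root are integers, all nonnegative or all
nonpositive. Crossing the wall `ker (b i)` replaces `b` by the root basis consisting of `-b i` and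
some `b j + c j • b i`, so that the objects of `C(𝒜, R, K)` are ordered root bases and the scheme is
*realized* in `V*` by `R`. For any connected scheme realized by a reduced set `R`, the number of
roots that are positive for one root basis and negative for another one drops on crossing a suitable
wall; by induction on this number, every root basis arises from an object, and `R` is the set of
real roots at each object. Hence the scheme determines `R` up to a linear map, and conversely.

If a scheme has finite type, then transporting the real roots to `V*` along morphisms to a fixed
object realizes it; simple connectedness makes this well defined, and the kernels of the resulting
set form an arrangement whose chambers are the dual cones of the transported bases. -/

noncomputable section

/-! ### Root bases -/

namespace RootBasis

section Range

variable {A M ι κ : Type*} [Ring A] [Nontrivial A] [AddCommGroup M] [Module A M]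
  {b : Basis ι A M} {b' : Basis κ A M}

theorem range_eq_of_range_subset (h : Set.range b ⊆ Set.range b') : Set.range b = Set.range b' :=
  b.maximal _ b'.linearIndependent.linearIndepOn_id h

theorem exists_reindex_eq_of_range_eq (h : Set.range b = Set.range b') :
    ∃ e : ι ≃ κ, b.reindex e = b' := by
  let e : ι ≃ κ := (Equiv.ofInjective b b.injective).trans
    ((Equiv.setCongr h).trans (Equiv.ofInjective b' b'.injective).symm)
  have he (i : ι) : b' (e i) = b i :=
    congrArg Subtype.val ((Equiv.ofInjective b' b'.injective).apply_symm_apply _)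
  refine ⟨e, Basis.eq_of_apply_eq fun k => ?_⟩
  rw [Basis.reindex_apply, ← he, e.apply_symm_apply]

end Range

variable {𝕜 W W' ι κ : Type*} [Field 𝕜] [AddCommGroup W] [Module 𝕜 W] [AddCommGroup W']
  [Module 𝕜 W']

/-- A finite symmetric set of vectors that meets the line `𝕜 x` of each of its members `x` only in
`± x`. Over a field of characteristic zero this excludes `x = 0`. -/
structure IsReducedSet (𝕜 : Type*) [Field 𝕜] {W : Type*} [AddCommGroup W] [Module 𝕜 W]
    (R : Set W) : Prop where
  finite : R.Finite
  neg_mem : ∀ x ∈ R, -x ∈ R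
  reduced : ∀ x ∈ R, ∀ t : 𝕜, t • x ∈ R → t = 1 ∨ t = -1

/-- The basis `b'` arises from `b` by `b i ↦ - b i` and `b j ↦ b j + c j • b i` for `j ≠ i`, for
some scalars `c j`. -/
structure IsStep (b : Basis ι 𝕜 W) (i : ι) (b' : Basis ι 𝕜 W) : Prop where
  apply_self : b' i = -b i
  apply_of_ne : ∀ j, j ≠ i → ∃ c : 𝕜, b' j = b j + c • b i

/-- The sum of the coordinates with index in `s`. -/
def height (b : Basis ι 𝕜 W) (s : Set ι) : W →ₗ[𝕜] 𝕜 := b.constr 𝕜 (s.indicator 1)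

theorem height_basis (b : Basis ι 𝕜 W) (s : Set ι) (j : ι) :
    height b s (b j) = s.indicator 1 j := b.constr_basis 𝕜 _ j

theorem height_apply (b : Basis ι 𝕜 W) (s : Set ι) (x : W) :
    height b s x = ∑ j ∈ (b.repr x).support, b.repr x j * s.indicator 1 j := b.constr_apply 𝕜 _ x

theorem height_basis_of_mem (b : Basis ι 𝕜 W) {s : Set ι} {j : ι} (hj : j ∈ s) :
    height b s (b j) = 1 := by
  rw [height_basis, Set.indicator_of_mem hj, Pi.one_apply]

theorem height_basis_of_notMem (b : Basis ι 𝕜 W) {s : Set ι} {j : ι} (hj : j ∉ s) :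
    height b s (b j) = 0 := by
  rw [height_basis, Set.indicator_of_notMem hj]

theorem IsReducedSet.map {R : Set W} (hR : IsReducedSet 𝕜 R) (ψ : W ≃ₗ[𝕜] W') :
    IsReducedSet 𝕜 (ψ '' R) where
  finite := hR.finite.image ψ
  neg_mem := by
    rintro _ ⟨x, hx, rfl⟩
    exact ⟨-x, hR.neg_mem x hx, map_neg ψ x⟩
  reduced := by
    rintro _ ⟨x, hx, rfl⟩ t ht
    rw [← map_smul, ψ.injective.mem_set_image] at ht
    exact hR.reduced x hx t ht

namespace IsStep

variable {b b' : Basis ι 𝕜 W} {i : ι}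

theorem symm (h : IsStep b i b') : IsStep b' i b where
  apply_self := by rw [h.apply_self, neg_neg]
  apply_of_ne j hj := by
    obtain ⟨c, hc⟩ := h.apply_of_ne j hj
    exact ⟨c, by rw [hc, h.apply_self]; module⟩

theorem repr_eq (h : IsStep b i b') {j : ι} (hj : j ≠ i) (x : W) :
    b'.repr x j = b.repr x j := by
  classical
  suffices b'.coord j = b.coord j from LinearMap.congr_fun this x
  refine b'.ext fun k => ?_
  rw [Basis.coord_apply, Basis.coord_apply, Basis.repr_self]
  by_cases hk : k = i
  · simp [hk, h.apply_self, hj.symm]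
  · obtain ⟨c, hc⟩ := h.apply_of_ne k hk
    simp [hc, Finsupp.single_apply, hj.symm]

theorem reindex (h : IsStep b i b') (e : ι ≃ κ) : IsStep (b.reindex e) (e i) (b'.reindex e) where
  apply_self := by simp [h.apply_self]
  apply_of_ne j hj := by
    obtain ⟨c, hc⟩ := h.apply_of_ne (e.symm j) fun hji => hj (e.symm_apply_eq.1 hji)
    exact ⟨c, by simp [hc]⟩

end IsStep

variable [LinearOrder 𝕜]

/-- The vector `x` lies in the closed cone spanned by the basis `b`. -/
def IsPos (b : Basis ι 𝕜 W) (x : W) : Prop := ∀ i, 0 ≤ b.repr x i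

/-- A simple system of `R`: a basis contained in `R` such that the coordinates of every element of
`R` have the same sign. -/
structure IsSimpleSystem (R : Set W) (b : Basis ι 𝕜 W) : Prop where
  mem : ∀ i, b i ∈ R
  pos_or_neg : ∀ x ∈ R, IsPos b x ∨ IsPos b (-x)

/-- A simple system for which the coordinates of the elements of `R` are integers. -/
structure IsRootBasis (R : Set W) (b : Basis ι 𝕜 W) : Prop extends IsSimpleSystem R b where
  integral : ∀ x ∈ R, ∀ i, ∃ n : ℤ, b.repr x i = n

theorem IsRootBasis.map {R : Set W} {b : Basis ι 𝕜 W} (hb : IsRootBasis R b) (ψ : W ≃ₗ[𝕜] W') :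
    IsRootBasis (ψ '' R) (b.map ψ) where
  mem i := ⟨b i, hb.mem i, by simp⟩
  integral := by
    rintro _ ⟨x, hx, rfl⟩ i
    simpa using hb.integral x hx i
  pos_or_neg := by
    rintro _ ⟨x, hx, rfl⟩
    simpa [IsPos] using hb.pos_or_neg x hx

theorem isPos_reindex_iff {b : Basis ι 𝕜 W} (e : ι ≃ κ) {x : W} :
    IsPos (b.reindex e) x ↔ IsPos b x := by
  simp only [IsPos, Basis.repr_reindex_apply]
  exact e.symm.forall_congr_right (q := fun i => 0 ≤ b.repr x i)

theorem IsRootBasis.reindex {R : Set W} {b : Basis ι 𝕜 W} (hb : IsRootBasis R b) (e : ι ≃ κ) :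
    IsRootBasis R (b.reindex e) where
  mem k := by simpa using hb.mem _
  integral x hx k := by simpa using hb.integral x hx (e.symm k)
  pos_or_neg x hx := by simpa only [isPos_reindex_iff] using hb.pos_or_neg x hx

theorem IsRootBasis.of_range_eq {R : Set W} {b : Basis ι 𝕜 W} {b' : Basis κ 𝕜 W}
    (hb : IsRootBasis R b) (h : Set.range b = Set.range b') : IsRootBasis R b' := by
  obtain ⟨e, rfl⟩ := exists_reindex_eq_of_range_eq h
  exact hb.reindex e

theorem IsRootBasis.map_neg {R : Set W} {b : Basis ι 𝕜 W} (hR : IsReducedSet 𝕜 R)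
    (hb : IsRootBasis R b) : IsRootBasis R (b.map (LinearEquiv.neg 𝕜)) := by
  have hneg : LinearEquiv.neg 𝕜 '' R = R :=
    (Set.image_subset_iff.2 hR.neg_mem).antisymm fun x hx => ⟨-x, hR.neg_mem x hx, neg_neg x⟩
  simpa only [hneg] using hb.map (LinearEquiv.neg 𝕜)

theorem IsPos.exists_repr_pos {b : Basis ι 𝕜 W} {x : W} (h : IsPos b x) (hx : x ≠ 0) :
    ∃ j, 0 < b.repr x j := by
  by_contra! H
  exact hx (b.ext_elem fun j => by simpa using le_antisymm (H j) (h j))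

/-- The positive roots of `b₀` that are negative roots of `b`. They correspond to the hyperplanes
separating the chamber of `b` from that of `b₀`. -/
def inversions (R : Set W) (b₀ : Basis κ 𝕜 W) (b : Basis ι 𝕜 W) : Set W :=
  {x | x ∈ R ∧ IsPos b₀ x ∧ ¬IsPos b x}

theorem finite_inversions {R : Set W} (hR : IsReducedSet 𝕜 R) (b₀ : Basis κ 𝕜 W) (b : Basis ι 𝕜 W) :
    (inversions R b₀ b).Finite :=
  hR.finite.subset fun _ hx => hx.1

variable [IsStrictOrderedRing 𝕜] {R : Set W} {b b₀ b₁ b₂ : Basis ι 𝕜 W} {b' : Basis κ 𝕜 W} {i : ι}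
  {x : W}

theorem IsReducedSet.ne_zero (hR : IsReducedSet 𝕜 R) (hx : x ∈ R) : x ≠ 0 := by
  rintro rfl
  have h := hR.reduced 0 hx 2 (by rwa [smul_zero])
  norm_num at h

theorem isPos_self (b : Basis ι 𝕜 W) (i : ι) : IsPos b (b i) := by
  classical
  intro j
  rw [Basis.repr_self, Finsupp.single_apply]
  split_ifs <;> norm_num

theorem not_isPos_neg (hx : x ≠ 0) (h : IsPos b x) : ¬IsPos b (-x) := fun h' =>
  hx (b.ext_elem fun i => le_antisymm (by simpa using h' i) (by simpa using h i))

theorem not_isPos_neg_self (b : Basis ι 𝕜 W) (i : ι) : ¬IsPos b (-b i) :=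
  not_isPos_neg (b.ne_zero i) (isPos_self b i)

theorem IsSimpleSystem.isPos_neg_iff (hR : IsReducedSet 𝕜 R) (hb : IsSimpleSystem R b)
    (hx : x ∈ R) : IsPos b (-x) ↔ ¬IsPos b x :=
  ⟨fun h h' => not_isPos_neg (hR.ne_zero hx) h' h, (hb.pos_or_neg x hx).resolve_left⟩

theorem IsSimpleSystem.isPos_of_repr_pos (hb : IsSimpleSystem R b) (hx : x ∈ R) {j : ι}
    (hj : 0 < b.repr x j) : IsPos b x :=
  (hb.pos_or_neg x hx).resolve_right fun h => (h j).not_gt (by simpa using hj)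

theorem isPos_of_support (hx : IsPos b' x) (h : ∀ k, b'.repr x k ≠ 0 → IsPos b (b' k)) :
    IsPos b x := fun i => by
  rw [← b'.linearCombination_repr x, Finsupp.linearCombination_apply, Finsupp.sum, map_sum,
    Finsupp.finsetSum_apply]
  refine Finset.sum_nonneg fun k hk => ?_
  rw [map_smul, Finsupp.smul_apply]
  exact mul_nonneg (hx k) (h k (Finsupp.mem_support_iff.1 hk) i)

theorem isPos_map_neg_iff : IsPos (b.map (LinearEquiv.neg 𝕜)) x ↔ IsPos b (-x) := by
  simp [IsPos]

theorem isPos_neg_of_support (hx : IsPos b' x) (h : ∀ k, b'.repr x k ≠ 0 → IsPos b (-b' k)) :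
    IsPos b (-x) :=
  isPos_map_neg_iff.1 (isPos_of_support hx fun k hk => isPos_map_neg_iff.2 (h k hk))

/-! ### Simple roots are determined by the positive roots -/

theorem IsRootBasis.one_le_repr (hb : IsRootBasis R b) (hx : x ∈ R) {j : ι}
    (h : 0 < b.repr x j) : 1 ≤ b.repr x j := by
  obtain ⟨n, hn⟩ := hb.integral x hx j
  rw [hn] at h ⊢
  exact_mod_cast h

theorem IsRootBasis.one_le_height (hb : IsRootBasis R b) (hx : x ∈ R) (hpos : IsPos b x)
    {s : Set ι} {j : ι} (hj : j ∈ s) (h : 0 < b.repr x j) : 1 ≤ height b s x := by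
  rw [height_apply]
  refine (hb.one_le_repr hx h).trans (le_of_eq_of_le ?_ (Finset.single_le_sum
    (fun k _ => mul_nonneg (hpos k) ?_) (Finsupp.mem_support_iff.2 h.ne')))
  · rw [Set.indicator_of_mem hj, Pi.one_apply, mul_one]
  · exact Set.indicator_nonneg (fun _ _ => zero_le_one) k

theorem IsReducedSet.exists_repr_pos_of_ne (hR : IsReducedSet 𝕜 R) (hi : b i ∈ R) (hx : x ∈ R)
    (hpos : IsPos b x) (hne : x ≠ b i) : ∃ j, j ≠ i ∧ 0 < b.repr x j := by
  classical
  by_contra! H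
  have hxi : x = b.repr x i • b i := b.ext_elem fun j => by
    by_cases hj : j = i
    · simp [hj]
    · simp [le_antisymm (H j hj) (hpos j), Ne.symm hj]
  rcases hR.reduced _ hi (b.repr x i) (hxi ▸ hx) with h | h
  · exact hne (by rw [hxi, h, one_smul])
  · exact absurd (hpos i) (by rw [h]; norm_num)

theorem IsRootBasis.exists_repr_eq_one (hb : IsRootBasis R b) (f : W →ₗ[𝕜] 𝕜)
    (hf : ∀ k, f (b k) = 0 ∨ 1 ≤ f (b k)) (hx : x ∈ R) (hpos : IsPos b x) (hfx : f x = 1) :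
    ∃ k, f (b k) = 1 ∧ b.repr x k = 1 ∧ ∀ l, l ≠ k → f (b l) ≠ 0 → b.repr x l = 0 := by
  classical
  have hsum : ∑ k ∈ (b.repr x).support, b.repr x k * f (b k) = 1 := by
    conv_rhs => rw [← hfx, ← b.linearCombination_repr x, Finsupp.linearCombination_apply]
    simp [Finsupp.sum]
  have hnn (k : ι) : 0 ≤ b.repr x k * f (b k) :=
    mul_nonneg (hpos k) (by rcases hf k with h | h <;> linarith)
  obtain ⟨k, hk, hne⟩ := Finset.exists_ne_zero_of_sum_ne_zero (hsum.trans_ne one_ne_zero)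
  have hrepr := hb.one_le_repr hx ((hpos k).lt_of_ne' (left_ne_zero_of_mul hne))
  have hfk := (hf k).resolve_left (right_ne_zero_of_mul hne)
  rw [← Finset.add_sum_erase _ _ hk] at hsum
  have hrest_nonneg := Finset.sum_nonneg fun l (_ : l ∈ (b.repr x).support.erase k) => hnn l
  have hrest : ∑ l ∈ (b.repr x).support.erase k, b.repr x l * f (b l) = 0 := by nlinarith
  refine ⟨k, by nlinarith, by nlinarith, fun l hl hfl => ?_⟩
  by_contra hlx
  have hl0 := (Finset.sum_eq_zero_iff_of_nonneg fun l _ => hnn l).1 hrest l (by simp [hl, hlx])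
  exact mul_ne_zero hlx hfl hl0

theorem IsRootBasis.range_eq_of_forall_isPos (hb : IsRootBasis R b)
    (hb' : IsRootBasis R b') (h : ∀ k, IsPos b (b' k)) : Set.range b = Set.range b' := by
  refine range_eq_of_range_subset ?_
  rintro _ ⟨j, rfl⟩
  have hpos : IsPos b' (b j) := (hb'.pos_or_neg _ (hb.mem j)).resolve_right fun hn =>
    not_isPos_neg_self b j (isPos_of_support hn fun k _ => h k)
  have hf (k : κ) : 1 ≤ height b Set.univ (b' k) := by
    obtain ⟨l, hl⟩ := (h k).exists_repr_pos (b'.ne_zero k)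
    exact hb.one_le_height (hb'.mem k) (h k) (Set.mem_univ l) hl
  obtain ⟨k, -, hk, h0⟩ := hb'.exists_repr_eq_one _ (fun k => Or.inr (hf k)) (hb.mem j) hpos
    (height_basis_of_mem b (Set.mem_univ j))
  refine ⟨k, b'.ext_elem fun l => ?_⟩
  rcases eq_or_ne l k with rfl | hl
  · simp [hk]
  · rw [h0 l hl (by linarith [hf l])]
    simp [hl.symm]

/-! ### Crossing a wall -/

/-- Every positive root of `b` except the simple root `b i` is a positive root of `b'`. -/
structure Crosses (R : Set W) (b : Basis ι 𝕜 W) (i : ι) (b' : Basis κ 𝕜 W) : Prop where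
  not_isPos : ¬IsPos b' (b i)
  isPos : ∀ x ∈ R, x ≠ b i → IsPos b x → IsPos b' x

namespace Crosses

theorem eq_neg_or_one_le_height (h : Crosses R b i b') (hR : IsReducedSet 𝕜 R)
    (hb : IsRootBasis R b) (hb' : IsRootBasis R b') (k : κ) :
    b' k = -b i ∨ 1 ≤ height b {i}ᶜ (b' k) := by
  refine or_iff_not_imp_left.2 fun hk => ?_
  have hpos : IsPos b (b' k) := (hb.pos_or_neg _ (hb'.mem k)).resolve_right fun hn =>
    not_isPos_neg_self b' k
      (h.isPos _ (hR.neg_mem _ (hb'.mem k)) (fun h => hk (neg_eq_iff_eq_neg.1 h)) hn)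
  have hne : b' k ≠ b i := fun hk => h.not_isPos (hk ▸ isPos_self b' k)
  obtain ⟨j, hj, hlt⟩ := hR.exists_repr_pos_of_ne (hb.mem i) (hb'.mem k) hpos hne
  exact hb.one_le_height (hb'.mem k) hpos hj hlt

theorem neg_mem_range (h : Crosses R b i b') (hR : IsReducedSet 𝕜 R) (hb : IsRootBasis R b)
    (hb' : IsRootBasis R b') : -b i ∈ Set.range b' := by
  by_contra H
  have hf (k : κ) := (h.eq_neg_or_one_le_height hR hb hb' k).resolve_left fun hk => H ⟨k, hk⟩
  have hneg : IsPos b' (-b i) := (hb'.isPos_neg_iff hR (hb.mem i)).2 h.not_isPos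
  obtain ⟨k, hk⟩ := hneg.exists_repr_pos (neg_ne_zero.2 (b.ne_zero i))
  have hpos : 0 < height b {i}ᶜ (-b i) := by
    rw [← b'.linearCombination_repr (-b i), Finsupp.linearCombination_apply, Finsupp.sum, map_sum]
    refine Finset.sum_pos' (fun l _ => ?_) ⟨k, Finsupp.mem_support_iff.2 hk.ne', ?_⟩
    · rw [map_smul]
      exact mul_nonneg (hneg l) (zero_le_one.trans (hf l))
    · rw [map_smul]
      exact mul_pos hk (zero_lt_one.trans_le (hf k))
  rw [map_neg, height_basis_of_notMem b (by simp), neg_zero] at hpos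
  exact hpos.false

theorem exists_add_nsmul_mem_range (h : Crosses R b i b') (hR : IsReducedSet 𝕜 R)
    (hb : IsRootBasis R b) (hb' : IsRootBasis R b') {j : ι} (hj : j ≠ i) :
    ∃ n : ℕ, b j + n • b i ∈ Set.range b' := by
  classical
  obtain ⟨k₀, hk₀⟩ := h.neg_mem_range hR hb hb'
  have hi : height b {i}ᶜ (b i) = 0 := height_basis_of_notMem b (by simp)
  have hf (k : κ) : height b {i}ᶜ (b' k) = 0 ∨ 1 ≤ height b {i}ᶜ (b' k) :=
    (h.eq_neg_or_one_le_height hR hb hb' k).imp_left fun hk => by rw [hk, map_neg, hi, neg_zero]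
  have hpos : IsPos b' (b j) := h.isPos _ (hb.mem j) (b.injective.ne hj) (isPos_self b j)
  obtain ⟨k, hfk, hk, h0⟩ := hb'.exists_repr_eq_one _ hf (hb.mem j) hpos
    (height_basis_of_mem b hj)
  obtain ⟨n, hn⟩ := hb'.integral _ (hb.mem j) k₀
  lift n to ℕ using by exact_mod_cast hn ▸ hpos k₀
  have hkk₀ : k ≠ k₀ := by
    rintro rfl
    rw [hk₀, map_neg, hi, neg_zero] at hfk
    exact zero_ne_one hfk
  have hsum : b j = b' k + (n : 𝕜) • b' k₀ := b'.ext_elem fun l => by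
    by_cases hl₀ : l = k₀
    · simp [hl₀, hn, hkk₀]
    by_cases hl : l = k
    · simp [hl, hk, hkk₀.symm]
    have hfl : height b {i}ᶜ (b' l) ≠ 0 := (zero_lt_one.trans_le
      ((h.eq_neg_or_one_le_height hR hb hb' l).resolve_left fun hl =>
        hl₀ (b'.injective (hl.trans hk₀.symm)))).ne'
    simp [h0 l hl hfl, Ne.symm hl, Ne.symm hl₀]
  refine ⟨n, k, ?_⟩
  rw [hsum, hk₀, ← Nat.cast_smul_eq_nsmul 𝕜]
  module

end Crosses

namespace IsStep

theorem not_isPos (h : IsStep b i b₁) : ¬IsPos b₁ (b i) := by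
  have hn := not_isPos_neg_self b₁ i
  rwa [h.apply_self, neg_neg] at hn

theorem crosses (h : IsStep b i b₁) (hR : IsReducedSet 𝕜 R) (hb : IsRootBasis R b)
    (hb₁ : IsRootBasis R b₁) : Crosses R b i b₁ where
  not_isPos := h.not_isPos
  isPos y hy hne hpos := by
    obtain ⟨j, hj, hlt⟩ := hR.exists_repr_pos_of_ne (hb.mem i) hy hpos hne
    exact hb₁.isPos_of_repr_pos hy (by rwa [h.repr_eq hj])

theorem isPos_iff (h : IsStep b i b₁) (hR : IsReducedSet 𝕜 R) (hb : IsRootBasis R b)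
    (hb₁ : IsRootBasis R b₁) (hx : x ∈ R) (hne : x ≠ b i) (hne' : x ≠ -b i) :
    IsPos b₁ x ↔ IsPos b x := by
  refine ⟨(h.symm.crosses hR hb₁ hb).isPos x hx ?_, (h.crosses hR hb hb₁).isPos x hx hne⟩
  rwa [h.apply_self]

theorem coeff_le (h₁ : IsStep b i b₁) (hb₁ : IsRootBasis R b₁) (hb₂ : IsRootBasis R b₂) {j : ι}
    (hj : j ≠ i) {c d : 𝕜} (hc : b₁ j = b j + c • b i) (hd : b₂ j = b j + d • b i) : d ≤ c := by
  have e : b₂ j = b₁ j + (c - d) • b₁ i := by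
    rw [hc, hd, h₁.apply_self]
    module
  have hpos : IsPos b₁ (b₂ j) :=
    hb₁.isPos_of_repr_pos (hb₂.mem j) (j := j) (by simp [e, hj.symm])
  simpa [e, hj] using hpos i

theorem unique (h₁ : IsStep b i b₁) (h₂ : IsStep b i b₂) (hb₁ : IsRootBasis R b₁)
    (hb₂ : IsRootBasis R b₂) : b₁ = b₂ := by
  refine Basis.eq_of_apply_eq fun j => ?_
  by_cases hj : j = i
  · rw [hj, h₁.apply_self, h₂.apply_self]
  obtain ⟨c, hc⟩ := h₁.apply_of_ne j hj
  obtain ⟨d, hd⟩ := h₂.apply_of_ne j hj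
  rw [hc, hd, (h₂.coeff_le hb₂ hb₁ hj hd hc).antisymm (h₁.coeff_le hb₁ hb₂ hj hc hd)]

end IsStep

/-! ### Inversions -/

theorem IsStep.inversions_eq_insert (h : IsStep b i b₁) (hR : IsReducedSet 𝕜 R)
    (hb : IsRootBasis R b) (hb₁ : IsRootBasis R b₁) (hi : IsPos b' (b i)) :
    inversions R b' b₁ = insert (b i) (inversions R b' b) := by
  ext x
  by_cases hx : x = b i
  · simp only [hx, Set.mem_insert_iff, true_or, iff_true]
    exact ⟨hb.mem i, hi, h.not_isPos⟩
  simp only [Set.mem_insert_iff, hx, false_or]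
  refine and_congr_right fun hxR => and_congr_right fun hpos => not_congr ?_
  refine h.isPos_iff hR hb hb₁ hxR hx ?_
  rintro rfl
  exact not_isPos_neg (b.ne_zero i) hi hpos

theorem IsStep.ncard_inversions (h : IsStep b i b₁) (hR : IsReducedSet 𝕜 R)
    (hb : IsRootBasis R b) (hb₁ : IsRootBasis R b₁) (hi : IsPos b' (b i)) :
    (inversions R b' b₁).ncard = (inversions R b' b).ncard + 1 := by
  rw [h.inversions_eq_insert hR hb hb₁ hi, Set.ncard_insert_of_notMem
    (fun hmem => hmem.2.2 (isPos_self b i)) (finite_inversions hR b' b)]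

end RootBasis

/-! ### Rank two -/

namespace RootBasis

variable {𝕜 W ι κ : Type*} [Field 𝕜] [LinearOrder 𝕜] [AddCommGroup W] [Module 𝕜 W]

theorem inversions_self (R : Set W) (b : Basis ι 𝕜 W) : inversions R b b = ∅ :=
  Set.eq_empty_of_forall_notMem fun _ hx => hx.2.2 hx.2.1

/-- The positive roots of `b` in the plane spanned by `b i` and `b j`. -/
def planeRoots (R : Set W) (b : Basis ι 𝕜 W) (i j : ι) : Set W :=
  {x | x ∈ R ∧ IsPos b x ∧ ∀ k, k ≠ i → k ≠ j → b.repr x k = 0}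

theorem finite_planeRoots {R : Set W} (hR : IsReducedSet 𝕜 R) (b : Basis ι 𝕜 W) (i j : ι) :
    (planeRoots R b i j).Finite :=
  hR.finite.subset fun _ hx => hx.1

/-- A sequence `B` of root bases in which `B (n + 1)` arises from `B n` by a step in the direction
`l n`, the directions being alternatingly `i` and `j`. -/
structure IsAlternatingWalk (R : Set W) (i j : ι) (B : ℕ → Basis ι 𝕜 W) (l : ℕ → ι) : Prop where
  ne : i ≠ j
  rootBasis : ∀ n, IsRootBasis R (B n)
  mem : ∀ n, l n = i ∨ l n = j
  alternate : ∀ n, l (n + 1) ≠ l n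
  step : ∀ n, IsStep (B n) (l n) (B (n + 1))

namespace IsAlternatingWalk

variable {R : Set W} {i j : ι} {B : ℕ → Basis ι 𝕜 W} {l : ℕ → ι} {n : ℕ} {k : ι} {x : W}

theorem shift (h : IsAlternatingWalk R i j B l) (m : ℕ) :
    IsAlternatingWalk R i j (fun n => B (m + n)) (fun n => l (m + n)) where
  ne := h.ne
  rootBasis _ := h.rootBasis _
  mem _ := h.mem _
  alternate n := h.alternate (m + n)
  step n := h.step (m + n)

theorem repr_eq (h : IsAlternatingWalk R i j B l) (n : ℕ) (hi : k ≠ i) (hj : k ≠ j) (x : W) :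
    (B n).repr x k = (B 0).repr x k := by
  induction n with
  | zero => rfl
  | succ n ih =>
    rw [← ih]
    exact (h.step n).repr_eq (by rcases h.mem n with e | e <;> rwa [e]) x

theorem mem_planeRoots_iff (h : IsAlternatingWalk R i j B l) (n : ℕ) :
    x ∈ planeRoots R (B n) i j ↔
      x ∈ R ∧ IsPos (B n) x ∧ ∀ k, k ≠ i → k ≠ j → (B 0).repr x k = 0 :=
  and_congr_right fun _ => and_congr_right fun _ => forall_congr' fun _ =>
    forall₂_congr fun hi hj => by rw [h.repr_eq n hi hj]

theorem det_repr (h : IsAlternatingWalk R i j B l) (n : ℕ) :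
    (B 0).repr (B n i) i * (B 0).repr (B n j) j - (B 0).repr (B n i) j * (B 0).repr (B n j) i =
      (-1) ^ n := by
  induction n with
  | zero => simp [h.ne, h.ne.symm]
  | succ n ih =>
    have hs := h.step n
    rw [pow_succ, ← ih]
    rcases h.mem n with e | e <;> rw [e] at hs
    · obtain ⟨c, hc⟩ := hs.apply_of_ne j h.ne.symm
      simp only [hs.apply_self, hc, map_neg, map_add, map_smul, Finsupp.neg_apply,
        Finsupp.add_apply, Finsupp.smul_apply, smul_eq_mul]
      ring
    · obtain ⟨c, hc⟩ := hs.apply_of_ne i h.ne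
      simp only [hs.apply_self, hc, map_neg, map_add, map_smul, Finsupp.neg_apply,
        Finsupp.add_apply, Finsupp.smul_apply, smul_eq_mul]
      ring

variable [IsStrictOrderedRing 𝕜]

theorem inversions_subset (h : IsAlternatingWalk R i j B l) (n : ℕ) :
    inversions R (B 0) (B n) ⊆ planeRoots R (B 0) i j := by
  rintro x ⟨hx, hpos, hneg⟩
  refine ⟨hx, hpos, fun k hi hj => (hpos k).eq_of_not_lt' fun hk => hneg ?_⟩
  exact (h.rootBasis n).isPos_of_repr_pos hx (by rwa [h.repr_eq n hi hj])

theorem ncard_inversions_of_forall_isPos (h : IsAlternatingWalk R i j B l)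
    (hR : IsReducedSet 𝕜 R) (hpos : ∀ p < n, IsPos (B 0) (B p (l p))) :
    (inversions R (B 0) (B n)).ncard = n := by
  induction n with
  | zero => rw [inversions_self, Set.ncard_empty]
  | succ n ih =>
    rw [(h.step n).ncard_inversions hR (h.rootBasis n) (h.rootBasis (n + 1))
      (hpos n n.lt_succ_self), ih fun p hp => hpos p (hp.trans n.lt_succ_self)]

/-- As long as a positive root in the plane is not inverted, the walk moves away from `B 0`. -/
theorem isPos_apply (h : IsAlternatingWalk R i j B l) (hR : IsReducedSet 𝕜 R)
    (hn : n < (planeRoots R (B 0) i j).ncard) : IsPos (B 0) (B n (l n)) := by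
  induction n using Nat.strong_induction_on with
  | _ n ih =>
    rcases n with _ | p
    · exact isPos_self _ _
    by_contra hneg
    have hcard := h.ncard_inversions_of_forall_isPos hR fun q hq => ih q hq (hq.trans hn)
    have hp : IsPos (B 0) (-B (p + 1) (l p)) := by
      rw [(h.step p).apply_self, neg_neg]
      exact ih p p.lt_succ_self (p.lt_succ_self.trans hn)
    have hp' : IsPos (B 0) (-B (p + 1) (l (p + 1))) :=
      ((h.rootBasis 0).isPos_neg_iff hR ((h.rootBasis _).mem _)).2 hneg
    have hsub : planeRoots R (B 0) i j ⊆ inversions R (B 0) (B (p + 1)) := by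
      rintro x ⟨hx, hpos, h0⟩
      refine ⟨hx, hpos, fun hxp => not_isPos_neg (hR.ne_zero hx) hpos ?_⟩
      refine isPos_neg_of_support hxp fun k hk => ?_
      have hkij : k = i ∨ k = j := by
        by_contra! H
        exact hk ((h.repr_eq _ H.1 H.2 x).trans (h0 k H.1 H.2))
      have hkl : k = l p ∨ k = l (p + 1) := by grind [h.mem p, h.mem (p + 1), h.alternate p]
      rcases hkl with rfl | rfl
      exacts [hp, hp']
    have hle := Set.ncard_le_ncard hsub (finite_inversions hR _ _)
    lia

theorem ncard_inversions (h : IsAlternatingWalk R i j B l) (hR : IsReducedSet 𝕜 R)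
    (hn : n ≤ (planeRoots R (B 0) i j).ncard) : (inversions R (B 0) (B n)).ncard = n :=
  h.ncard_inversions_of_forall_isPos hR fun _ hp => h.isPos_apply hR (hp.trans_le hn)

theorem inversions_half (h : IsAlternatingWalk R i j B l) (hR : IsReducedSet 𝕜 R) :
    inversions R (B 0) (B (planeRoots R (B 0) i j).ncard) = planeRoots R (B 0) i j :=
  Set.eq_of_subset_of_ncard_le (h.inversions_subset _) (h.ncard_inversions hR le_rfl).ge
    (finite_planeRoots hR _ _ _)

theorem planeRoots_half (h : IsAlternatingWalk R i j B l) (hR : IsReducedSet 𝕜 R) :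
    planeRoots R (B (planeRoots R (B 0) i j).ncard) i j = -planeRoots R (B 0) i j := by
  have hhalf := h.inversions_half hR
  set m := (planeRoots R (B 0) i j).ncard
  ext x
  rw [Set.mem_neg, ← hhalf, h.mem_planeRoots_iff]
  constructor
  · rintro ⟨hx, hpos, h0⟩
    have hx0 : ¬IsPos (B 0) x := fun hx0 => by
      have hinv : x ∈ planeRoots R (B 0) i j := ⟨hx, hx0, h0⟩
      rw [← hhalf] at hinv
      exact hinv.2.2 hpos
    exact ⟨hR.neg_mem x hx, ((h.rootBasis 0).isPos_neg_iff hR hx).2 hx0,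
      not_isPos_neg (hR.ne_zero hx) hpos⟩
  · intro hinv
    have hx : x ∈ R := by simpa using hR.neg_mem _ hinv.1
    refine ⟨hx, ((h.rootBasis _).pos_or_neg x hx).resolve_right hinv.2.2, fun k hi hj => ?_⟩
    simpa using (h.inversions_subset _ hinv).2.2 k hi hj

theorem ncard_planeRoots_half (h : IsAlternatingWalk R i j B l) (hR : IsReducedSet 𝕜 R) :
    (planeRoots R (B (planeRoots R (B 0) i j).ncard) i j).ncard =
      (planeRoots R (B 0) i j).ncard := by
  rw [h.planeRoots_half hR, ← Set.image_neg_eq_neg, Set.ncard_image_of_injective _ neg_injective]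

theorem inversions_nonempty (h : IsAlternatingWalk R i j B l) (hR : IsReducedSet 𝕜 R)
    (h₀ : 0 < n) (hn : n < 2 * (planeRoots R (B 0) i j).ncard) :
    (inversions R (B 0) (B n)).Nonempty := by
  set m := (planeRoots R (B 0) i j).ncard
  rcases le_or_gt n m with hnm | hnm
  · exact Set.nonempty_of_ncard_ne_zero (by rw [h.ncard_inversions hR hnm]; exact h₀.ne')
  obtain ⟨p, rfl⟩ := Nat.exists_eq_add_of_le hnm.le
  have hhalf : (planeRoots R (B m) i j).ncard = m := h.ncard_planeRoots_half hR
  have hlt : (inversions R (B m) (B (m + p))).ncard < (planeRoots R (B m) i j).ncard := by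
    have hcard := (h.shift m).ncard_inversions (n := p) hR (by simp only [add_zero]; lia)
    simp only [add_zero] at hcard
    lia
  obtain ⟨x, ⟨hx, hpos, h0⟩, hinv⟩ := Set.exists_mem_notMem_of_ncard_lt_ncard hlt
    (finite_inversions hR _ _)
  have hxp : IsPos (B (m + p)) x := by
    by_contra hneg
    exact hinv ⟨hx, hpos, hneg⟩
  have hx0 : -x ∈ planeRoots R (B 0) i j := by
    rw [← Set.mem_neg, ← h.planeRoots_half hR]
    exact ⟨hx, hpos, h0⟩
  exact ⟨-x, hx0.1, hx0.2.1, not_isPos_neg (hR.ne_zero hx) hxp⟩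

theorem ncard_inversions_lt (h : IsAlternatingWalk R i j B l) (hR : IsReducedSet 𝕜 R)
    {b' : Basis κ 𝕜 W} (hi : IsPos b' (-B 0 i)) (hj : IsPos b' (-B 0 j)) (h₀ : 0 < n)
    (hn : n < 2 * (planeRoots R (B 0) i j).ncard) :
    (inversions R b' (B n)).ncard < (inversions R b' (B 0)).ncard := by
  have hneg {x : W} (hx : x ∈ inversions R (B 0) (B n)) : IsPos b' (-x) := by
    obtain ⟨-, hpos, h0⟩ := h.inversions_subset n hx
    refine isPos_neg_of_support hpos fun k hk => ?_
    by_cases hki : k = i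
    · rwa [hki]
    · rwa [not_imp_comm.1 (h0 k hki) hk]
  refine Set.ncard_lt_ncard ⟨fun x hx => ⟨hx.1, hx.2.1, fun hpos => ?_⟩, fun hsub => ?_⟩
    (finite_inversions hR _ _)
  · exact not_isPos_neg (hR.ne_zero hx.1) hx.2.1 (hneg ⟨hx.1, hpos, hx.2.2⟩)
  · obtain ⟨y, hy⟩ := h.inversions_nonempty hR h₀ hn
    have hinv : -y ∈ inversions R b' (B 0) :=
      ⟨hR.neg_mem y hy.1, hneg hy, not_isPos_neg (hR.ne_zero hy.1) hy.2.1⟩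
    exact (hsub hinv).2.2 (((h.rootBasis n).pos_or_neg y hy.1).resolve_left hy.2.2)

theorem inversions_full (h : IsAlternatingWalk R i j B l) (hR : IsReducedSet 𝕜 R) :
    inversions R (B 0) (B (2 * (planeRoots R (B 0) i j).ncard)) = ∅ := by
  refine Set.eq_empty_of_forall_notMem fun x hx => hx.2.2 ?_
  have hneg : -x ∈ planeRoots R (B (planeRoots R (B 0) i j).ncard) i j := by
    rw [h.planeRoots_half hR, Set.mem_neg, neg_neg]
    exact h.inversions_subset _ hx
  have hinv := (h.shift (planeRoots R (B 0) i j).ncard).inversions_half hR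
  simp only [add_zero, h.ncard_planeRoots_half hR, ← two_mul] at hinv
  rw [← hinv] at hneg
  exact ((h.rootBasis _).pos_or_neg x hx.1).resolve_right hneg.2.2

theorem full_eq (h : IsAlternatingWalk R i j B l) (hR : IsReducedSet 𝕜 R) :
    B (2 * (planeRoots R (B 0) i j).ncard) = B 0 := by
  classical
  set m := (planeRoots R (B 0) i j).ncard
  have hpos (k : ι) : IsPos (B (2 * m)) (B 0 k) := by
    by_contra hneg
    have hinv : B 0 k ∈ inversions R (B 0) (B (2 * m)) :=
      ⟨(h.rootBasis 0).mem k, isPos_self _ _, hneg⟩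
    rwa [h.inversions_full hR] at hinv
  obtain ⟨e, he⟩ := exists_reindex_eq_of_range_eq
    ((h.rootBasis (2 * m)).range_eq_of_forall_isPos (h.rootBasis 0) hpos)
  have hB (k : ι) : B (2 * m) k = B 0 (e k) := by simp [← he]
  have hfix (k : ι) (hi : k ≠ i) (hj : k ≠ j) : e k = k := by
    have hk := h.repr_eq (2 * m) hi hj (B (2 * m) k)
    rw [Basis.repr_self, hB, Basis.repr_self, Finsupp.single_eq_same, Finsupp.single_apply] at hk
    by_contra hne
    simp [hne] at hk
  -- The walk has even length and hence determinant `1`, so it cannot exchange `i` and `j`.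
  have hdet := h.det_repr (2 * m)
  have hswap : ¬(e i = j ∧ e j = i) := by
    rintro ⟨hi, hj⟩
    simp only [hB, hi, hj, Basis.repr_self, Finsupp.single_apply, h.ne, h.ne.symm, if_true,
      if_false, pow_mul, neg_one_sq, one_pow] at hdet
    norm_num at hdet
  have hone (k : ι) : e k = k := by grind [e.injective.eq_iff]
  exact Basis.eq_of_apply_eq fun k => by rw [hB, hone]

end IsAlternatingWalk

end RootBasis

/-! ### Realizations of Cartan schemes -/

namespace RootBasis

section OfCoords

variable {𝕜 W ι : Type*} [Field 𝕜] [AddCommGroup W] [Module 𝕜 W] [Fintype ι]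

/-- The vector with given integral coordinates. -/
def ofCoords (b : Basis ι 𝕜 W) : (ι → ℤ) →ₗ[ℤ] W := Fintype.linearCombination ℤ b

theorem ofCoords_apply (b : Basis ι 𝕜 W) (x : ι → ℤ) : ofCoords b x = ∑ j, x j • b j := rfl

theorem repr_ofCoords (b : Basis ι 𝕜 W) (x : ι → ℤ) (i : ι) : b.repr (ofCoords b x) i = x i := by
  classical
  simp [ofCoords_apply, Finsupp.single_apply]

theorem ofCoords_single [DecidableEq ι] (b : Basis ι 𝕜 W) (i : ι) :
    ofCoords b (Pi.single i 1) = b i := by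
  simp [ofCoords]

theorem ofCoords_injective [CharZero 𝕜] (b : Basis ι 𝕜 W) : Function.Injective (ofCoords b) :=
  fun x y h => funext fun i => Int.cast_injective (α := 𝕜) <| by
    rw [← repr_ofCoords b, h, repr_ofCoords]

variable [LinearOrder 𝕜]

theorem IsRootBasis.exists_ofCoords {R : Set W} {b : Basis ι 𝕜 W} (hb : IsRootBasis R b) {x : W}
    (hx : x ∈ R) : ∃ n, ofCoords b n = x := by
  choose n hn using hb.integral x hx
  exact ⟨n, b.ext_elem fun i => by rw [repr_ofCoords, hn]⟩

theorem isPos_ofCoords [IsStrictOrderedRing 𝕜] (b : Basis ι 𝕜 W) (x : ι → ℤ) :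
    IsPos b (ofCoords b x) ↔ ∀ i, 0 ≤ x i := by
  simp only [IsPos, repr_ofCoords, Int.cast_nonneg_iff]

end OfCoords

theorem exists_eq_nsmul_single_add_iff {ι : Type*} [DecidableEq ι] {i j : ι} (hij : i ≠ j)
    (x : ι → ℤ) :
    (∃ p q : ℕ, x = p • Pi.single i 1 + q • Pi.single j 1) ↔
      (∀ k, 0 ≤ x k) ∧ ∀ k, k ≠ i → k ≠ j → x k = 0 := by
  constructor
  · rintro ⟨p, q, rfl⟩
    refine ⟨fun k => ?_, fun k hi hj => by simp [hi, hj]⟩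
    have hsingle (l : ι) : (0 : ι → ℤ) ≤ Pi.single l 1 := Pi.single_nonneg.2 zero_le_one
    exact add_nonneg (nsmul_nonneg (hsingle i) p) (nsmul_nonneg (hsingle j) q) k
  · rintro ⟨hpos, h0⟩
    refine ⟨(x i).toNat, (x j).toNat, funext fun k => ?_⟩
    by_cases hi : k = i
    · simp [hi, hij, hpos i]
    by_cases hj : k = j
    · simp [hj, hij.symm, hpos j]
    simp [hi, hj, h0]

end RootBasis

namespace CartanQuadruple

open RootBasis

theorem ofCoords_s {𝕜 W : Type*} [Field 𝕜] [AddCommGroup W] [Module 𝕜 W]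
    {S : CartanQuadruple.{u, v}} {b b' : Basis S.I 𝕜 W} {a : S.A} {i : S.I}
    (hdiag : S.C a i i = 2) (hb : ∀ j, b' j = b j - S.C a i j • b i) (x : S.I → ℤ) :
    ofCoords b' (S.s a i x) = ofCoords b x := by
  suffices ofCoords b' ∘ₗ S.s a i = ofCoords b from LinearMap.congr_fun this x
  refine (Pi.basisFun ℤ S.I).ext fun j => ?_
  rw [LinearMap.comp_apply, s, Basis.constr_basis, map_sub, map_smul, simpleRoot, simpleRoot,
    ofCoords_single, ofCoords_single, Pi.basisFun_apply, ofCoords_single, hb j, hb i, hdiag]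
  module

variable {𝕜 W : Type*} [Field 𝕜] [LinearOrder 𝕜] [AddCommGroup W] [Module 𝕜 W]

/-- A realization of `S` in the set of roots `R`: root bases `β a` attached to the objects such that
the maps `ρ i` change the bases by the reflections prescribed by the matrices. -/
structure Realizes (S : CartanQuadruple.{u, v}) (R : Set W) (β : S.A → Basis S.I 𝕜 W) : Prop where
  reduced : IsReducedSet 𝕜 R
  rootBasis : ∀ a, IsRootBasis R (β a)
  diag : ∀ a i, S.C a i i = 2
  step : ∀ a i j, β (S.ρ i a) j = β a j - S.C a i j • β a i

/-- The alternating sequence `i, j, i, j, …` -/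
def alternating {I : Type*} (i j : I) (n : ℕ) : I := if Even n then i else j

/-- The sequence of objects obtained from `a` by applying `ρ i`, `ρ j`, `ρ i`, … -/
def alternatingWalk (S : CartanQuadruple.{u, v}) (i j : S.I) (a : S.A) : ℕ → S.A
  | 0 => a
  | n + 1 => S.ρ (alternating i j n) (S.alternatingWalk i j a n)

theorem iterate_eq_alternatingWalk (S : CartanQuadruple.{u, v}) (i j : S.I) (a : S.A) (m : ℕ) :
    (S.ρ i ∘ S.ρ j)^[m] a = S.alternatingWalk j i a (2 * m) := by
  induction m with
  | zero => rfl
  | succ m ih =>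
    rw [Function.iterate_succ_apply', ih, Nat.mul_succ]
    simp [alternatingWalk, alternating]

namespace Realizes

variable {S : CartanQuadruple.{u, v}} {R : Set W} {β : S.A → Basis S.I 𝕜 W}

theorem isStep (h : S.Realizes R β) (a : S.A) (i : S.I) : IsStep (β a) i (β (S.ρ i a)) where
  apply_self := by
    rw [h.step, h.diag]
    module
  apply_of_ne j _ := ⟨-(S.C a i j : 𝕜), by
    rw [h.step, neg_smul, Int.cast_smul_eq_zsmul, sub_eq_add_neg]⟩

theorem isAlternatingWalk (h : S.Realizes R β) (a : S.A) {i j : S.I} (hij : i ≠ j) :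
    IsAlternatingWalk R i j (fun n => β (S.alternatingWalk j i a n)) (alternating j i) where
  ne := hij
  rootBasis _ := h.rootBasis _
  mem n := (ite_eq_or_eq _ j i).symm
  alternate n := by by_cases hn : Even n <;> simp [alternating, Nat.even_add_one, hn, hij, hij.symm]
  step _ := h.isStep _ _

theorem ofCoords_morphism (h : S.Realizes R β) {a b : S.A} {w} (hw : S.IsMorphism a b w)
    (x : S.I → ℤ) : ofCoords (β b) (w x) = ofCoords (β a) x := by
  induction hw with
  | id => rfl
  | comp b w i _ ih => rw [LinearMap.comp_apply, ofCoords_s (h.diag b i) (h.step b i), ih]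

variable [IsStrictOrderedRing 𝕜]

theorem map_ρ_ρ (h : S.Realizes R β) (a : S.A) (i : S.I) : β (S.ρ i (S.ρ i a)) = β a :=
  (h.isStep _ i).unique (h.isStep a i).symm (h.rootBasis _) (h.rootBasis a)

/-- Moving through the wall of a simple root on which `f` is negative decreases the number of
positive roots on which `f` is negative. -/
theorem exists_forall_pos (h : S.Realizes R β) [Nonempty S.A] {f : W →ₗ[𝕜] 𝕜}
    (hf : ∀ x ∈ R, f x ≠ 0) : ∃ a, ∀ i, 0 < f (β a i) := by
  let N (a : S.A) : Set W := {x | x ∈ R ∧ IsPos (β a) x ∧ f x < 0}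
  let a := Function.argmin fun a => (N a).ncard
  refine ⟨a, fun i => lt_of_not_ge fun hle => ?_⟩
  have hi : f (β a i) < 0 := hle.lt_of_ne (hf _ ((h.rootBasis a).mem i))
  refine Function.not_lt_argmin (fun a => (N a).ncard) (S.ρ i a) (Set.ncard_lt_ncard ⟨?_, fun hs =>
    (h.isStep a i).not_isPos (hs ⟨(h.rootBasis a).mem i, isPos_self _ i, hi⟩).2.1⟩
    (h.reduced.finite.subset fun x hx => hx.1))
  rintro x ⟨hx, hpos, hneg⟩
  refine ⟨hx, ((h.isStep a i).isPos_iff h.reduced (h.rootBasis a) (h.rootBasis _) hx ?_ ?_).1 hpos,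
    hneg⟩
  · rintro rfl
    exact (h.isStep a i).not_isPos hpos
  · rintro rfl
    rw [map_neg] at hneg
    linarith

theorem exists_range_eq (h : S.Realizes R β) [Nonempty S.A] {κ : Type*} {b₀ : Basis κ 𝕜 W}
    (hb₀ : IsRootBasis R b₀) : ∃ a, Set.range (β a) = Set.range b₀ := by
  have hheight {x : W} (hx : x ∈ R) (hpos : IsPos b₀ x) : 1 ≤ height b₀ Set.univ x := by
    obtain ⟨j, hj⟩ := hpos.exists_repr_pos (h.reduced.ne_zero hx)
    exact hb₀.one_le_height hx hpos (Set.mem_univ j) hj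
  have hheight_neg {x : W} (hx : x ∈ R) (hneg : IsPos b₀ (-x)) : height b₀ Set.univ x ≤ -1 := by
    have := hheight (h.reduced.neg_mem x hx) hneg
    rw [map_neg] at this
    linarith
  obtain ⟨a, ha⟩ := h.exists_forall_pos (f := height b₀ Set.univ) fun x hx =>
    (hb₀.pos_or_neg x hx).elim (fun hpos => by linarith [hheight hx hpos])
      fun hneg => by linarith [hheight_neg hx hneg]
  refine ⟨a, (hb₀.range_eq_of_forall_isPos (h.rootBasis a) fun i => ?_).symm⟩
  refine (hb₀.pos_or_neg _ ((h.rootBasis a).mem i)).resolve_right fun hneg => ?_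
  linarith [ha i, hheight_neg ((h.rootBasis a).mem i) hneg]

/-- A root whose sign changes along a morphism is a simple root on the way. -/
theorem exists_apply_eq_of_isMorphism (h : S.Realizes R β) {a b : S.A} {w}
    (hw : S.IsMorphism a b w) {x : W} (hx : x ∈ R) (ha : IsPos (β a) x) (hb : ¬IsPos (β b) x) :
    ∃ c i, β c i = x := by
  induction hw with
  | id => exact absurd ha hb
  | comp b _ i _ ih =>
    by_cases hpos : IsPos (β b) x
    · by_contra! hne
      exact hb (((h.isStep b i).crosses h.reduced (h.rootBasis b) (h.rootBasis _)).isPos x hx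
        (hne b i).symm hpos)
    · exact ih hpos

theorem mem_iff (h : S.Realizes R β) [Nonempty S.A] (hc : S.IsConnected) {x : W} :
    x ∈ R ↔ ∃ a i, β a i = x := by
  refine ⟨fun hx => ?_, fun ⟨a, i, hi⟩ => hi ▸ (h.rootBasis a).mem i⟩
  obtain ⟨a⟩ := ‹Nonempty S.A›
  obtain ⟨a', ha'⟩ := h.exists_range_eq ((h.rootBasis a).map_neg h.reduced)
  have hopp : IsPos (β a') x ↔ ¬IsPos (β a) x := by
    obtain ⟨e, he⟩ := exists_reindex_eq_of_range_eq ha'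
    rw [← (h.rootBasis a).isPos_neg_iff h.reduced hx, ← isPos_map_neg_iff, ← he, isPos_reindex_iff]
  by_cases hpos : IsPos (β a) x
  · obtain ⟨w, hw⟩ := hc a a'
    exact h.exists_apply_eq_of_isMorphism hw hx hpos fun h' => hopp.1 h' hpos
  · obtain ⟨w, hw⟩ := hc a' a
    exact h.exists_apply_eq_of_isMorphism hw hx (hopp.2 hpos) hpos

theorem mem_realRoots_iff (h : S.Realizes R β) [Nonempty S.A] (hc : S.IsConnected) (a : S.A)
    (x : S.I → ℤ) : x ∈ S.realRoots a ↔ ofCoords (β a) x ∈ R := by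
  constructor
  · rintro ⟨b, w, j, hw, rfl⟩
    rw [h.ofCoords_morphism hw, simpleRoot, ofCoords_single]
    exact (h.rootBasis b).mem j
  · intro hx
    obtain ⟨b, j, hj⟩ := (h.mem_iff hc).1 hx
    obtain ⟨w, hw⟩ := hc b a
    refine ⟨b, w, j, hw, ofCoords_injective (β a) ?_⟩
    rw [h.ofCoords_morphism hw, simpleRoot, ofCoords_single, hj]

theorem image_realRoots (h : S.Realizes R β) [Nonempty S.A] (hc : S.IsConnected) (a : S.A) :
    ofCoords (β a) '' S.realRoots a = R := by
  rw [Set.ext fun x => h.mem_realRoots_iff hc a x]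
  exact Set.image_preimage_eq_of_subset fun x hx => (h.rootBasis a).exists_ofCoords hx

theorem ncard_plane (h : S.Realizes R β) [Nonempty S.A] (hc : S.IsConnected) (a : S.A)
    {i j : S.I} (hij : i ≠ j) :
    {x | x ∈ S.realRoots a ∧ ∃ p q : ℕ, x = p • S.simpleRoot i + q • S.simpleRoot j}.ncard =
      (planeRoots R (β a) i j).ncard := by
  rw [← Set.ncard_image_of_injective _ (ofCoords_injective (β a))]
  congr 1
  have hplane (x : S.I → ℤ) : ofCoords (β a) x ∈ planeRoots R (β a) i j ↔
      x ∈ S.realRoots a ∧ ∃ p q : ℕ, x = p • S.simpleRoot i + q • S.simpleRoot j := by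
    simp only [planeRoots, Set.mem_ofPred_eq, h.mem_realRoots_iff hc, simpleRoot, isPos_ofCoords,
      exists_eq_nsmul_single_add_iff hij, repr_ofCoords, Int.cast_eq_zero]
  rw [← Set.ext hplane]
  exact Set.image_preimage_eq_of_subset fun y (hy : y ∈ planeRoots R (β a) i j) =>
    (h.rootBasis a).exists_ofCoords hy.1

/-! ### Schemes with injective realizations are of finite type -/

theorem nonpos (h : S.Realizes R β) (a : S.A) {i j : S.I} (hij : i ≠ j) : S.C a i j ≤ 0 := by
  have hj : β (S.ρ i a) j = β a j - (S.C a i j : 𝕜) • β a i := by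
    rw [h.step, Int.cast_smul_eq_zsmul]
  have hpos : IsPos (β a) (β (S.ρ i a) j) :=
    (h.rootBasis a).isPos_of_repr_pos ((h.rootBasis _).mem j) (j := j) (by simp [hj, hij])
  simpa [hj, hij.symm] using hpos i

theorem zero (h : S.Realizes R β) (a : S.A) (i j : S.I) (h0 : S.C a i j = 0) : S.C a j i = 0 := by
  rcases eq_or_ne i j with rfl | hij
  · exact h0
  have hj : β (S.ρ i a) j = β a j := by rw [h.step, h0, zero_smul, sub_zero]
  have hi : β (S.ρ j a) i = -β (S.ρ i a) i - (S.C a j i : 𝕜) • β (S.ρ i a) j := by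
    rw [h.step, hj, (h.isStep a i).apply_self, neg_neg, Int.cast_smul_eq_zsmul]
  by_contra hne
  have hlt : (S.C a j i : 𝕜) < 0 := by exact_mod_cast (h.nonpos a hij.symm).lt_of_ne hne
  have hpos : IsPos (β (S.ρ i a)) (β (S.ρ j a) i) :=
    (h.rootBasis _).isPos_of_repr_pos ((h.rootBasis _).mem i) (j := j)
      (by simpa [hi, hij] using hlt)
  have hcoord := hpos i
  norm_num [hi, hij.symm] at hcoord

theorem C_ρ (h : S.Realizes R β) (i j : S.I) (a : S.A) : S.C a i j = S.C (S.ρ i a) i j := by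
  have hj := h.step (S.ρ i a) i j
  rw [h.map_ρ_ρ, h.step a i j, (h.isStep a i).apply_self] at hj
  have hcoeff : ((S.C (S.ρ i a) i j - S.C a i j : ℤ) : 𝕜) • β a i = 0 := by
    rw [Int.cast_smul_eq_zsmul, ← sub_eq_zero.2 hj.symm]
    module
  have hzero := (smul_eq_zero.1 hcoeff).resolve_right ((β a).ne_zero i)
  exact (sub_eq_zero.1 (Int.cast_eq_zero.1 hzero)).symm

theorem isCartanScheme (h : S.Realizes R β) [Nonempty S.A] [Nonempty S.I]
    (hβ : Function.Injective β) : S.IsCartanScheme where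
  nonempty_I := inferInstance
  nonempty_A := inferInstance
  cartan a := ⟨h.diag a, fun _ _ => h.nonpos a, h.zero a⟩
  ρ_ρ i a := hβ (h.map_ρ_ρ a i)
  C_ρ := h.C_ρ

theorem realRoots_eq_pos_union_neg (h : S.Realizes R β) [Nonempty S.A] (hc : S.IsConnected)
    (a : S.A) : S.realRoots a =
      {x | x ∈ S.realRoots a ∧ ∀ k, 0 ≤ x k} ∪ {x | -x ∈ S.realRoots a ∧ ∀ k, 0 ≤ (-x) k} := by
  ext x
  have hneg : -x ∈ S.realRoots a ↔ x ∈ S.realRoots a := by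
    rw [h.mem_realRoots_iff hc, h.mem_realRoots_iff hc, map_neg]
    exact ⟨fun hx => by simpa using h.reduced.neg_mem _ hx, h.reduced.neg_mem _⟩
  simp only [Set.mem_union, Set.mem_ofPred_eq, hneg, ← and_or_left]
  refine (and_iff_left_of_imp fun hx => ?_).symm
  have hsign := (h.rootBasis a).pos_or_neg _ ((h.mem_realRoots_iff hc a x).1 hx)
  rwa [← map_neg, isPos_ofCoords, isPos_ofCoords] at hsign

theorem realRoots_inter_line (h : S.Realizes R β) [Nonempty S.A] (hc : S.IsConnected) (a : S.A)
    (i : S.I) : {x | x ∈ S.realRoots a ∧ ∃ t : ℤ, x = t • S.simpleRoot i} =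
      {S.simpleRoot i, -S.simpleRoot i} := by
  have hi : ofCoords (β a) (S.simpleRoot i) = β a i := ofCoords_single _ i
  have hmem := (h.rootBasis a).mem i
  ext x
  simp only [Set.mem_ofPred_eq, Set.mem_insert_iff, Set.mem_singleton_iff]
  constructor
  · rintro ⟨hx, t, rfl⟩
    rw [h.mem_realRoots_iff hc, map_smul, hi, ← Int.cast_smul_eq_zsmul 𝕜] at hx
    have ht : t = 1 ∨ t = -1 := by exact_mod_cast h.reduced.reduced _ hmem _ hx
    rcases ht with rfl | rfl <;> simp
  · rintro (rfl | rfl)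
    · exact ⟨(h.mem_realRoots_iff hc a _).2 (hi ▸ hmem), 1, by simp⟩
    · refine ⟨(h.mem_realRoots_iff hc a _).2 ?_, -1, by simp⟩
      rw [map_neg, hi]
      exact h.reduced.neg_mem _ hmem

theorem s_image_realRoots (h : S.Realizes R β) [Nonempty S.A] (hc : S.IsConnected) (a : S.A)
    (i : S.I) : S.s a i '' S.realRoots a = S.realRoots (S.ρ i a) := by
  have hs (a : S.A) (x : S.I → ℤ) := ofCoords_s (h.diag a i) (h.step a i) x
  refine (Set.image_subset_iff.2 fun x hx => ?_).antisymm fun y hy => ?_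
  · rw [Set.mem_preimage, h.mem_realRoots_iff hc, hs]
    exact (h.mem_realRoots_iff hc a x).1 hx
  · have hback := hs (S.ρ i a) y
    rw [h.map_ρ_ρ] at hback
    refine ⟨S.s (S.ρ i a) i y, ?_, ofCoords_injective (β (S.ρ i a)) ?_⟩
    · rwa [h.mem_realRoots_iff hc, hback, ← h.mem_realRoots_iff hc]
    · rw [hs, hback]

theorem isRootSystem (h : S.Realizes R β) [Nonempty S.A] (hc : S.IsConnected)
    (hβ : Function.Injective β) : S.IsRootSystem S.realRoots where
  R1 := h.realRoots_eq_pos_union_neg hc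
  R2 := h.realRoots_inter_line hc
  R3 := h.s_image_realRoots hc
  R4 a i j hij _ := by
    rw [iterate_eq_alternatingWalk, h.ncard_plane hc a hij]
    exact hβ ((h.isAlternatingWalk a hij).full_eq h.reduced)

theorem isFiniteType (h : S.Realizes R β) [Nonempty S.A] [Nonempty S.I] (hc : S.IsConnected)
    (hβ : Function.Injective β) : S.IsFiniteType where
  scheme := h.isCartanScheme hβ
  connected := hc
  simplyConnected a _ hw := LinearMap.ext fun x =>
    ofCoords_injective (β a) (h.ofCoords_morphism hw x)
  rootSystem := h.isRootSystem hc hβ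
  finite a := by
    refine Set.Finite.of_finite_image (f := ofCoords (β a)) ?_ (ofCoords_injective _).injOn
    rw [h.image_realRoots hc]
    exact h.reduced.finite

end Realizes

end CartanQuadruple

/-! ### Comparison of realizations -/

namespace CartanQuadruple

open RootBasis

variable {𝕜 W W' : Type*} [Field 𝕜] [LinearOrder 𝕜] [AddCommGroup W] [Module 𝕜 W]
  [AddCommGroup W'] [Module 𝕜 W'] {S : CartanQuadruple.{u, v}} {T : CartanQuadruple.{u', v'}}
  {R : Set W} {β : S.A → Basis S.I 𝕜 W}

namespace Realizes

theorem map (h : S.Realizes R β) (ψ : W ≃ₗ[𝕜] W') :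
    S.Realizes (ψ '' R) fun a => (β a).map ψ where
  reduced := h.reduced.map ψ
  rootBasis a := (h.rootBasis a).map ψ
  diag := h.diag
  step a i j := by simp [h.step]

variable [IsStrictOrderedRing 𝕜]

section SameRoots

variable {β' : T.A → Basis T.I 𝕜 W} {e : S.I ≃ T.I} {a : S.A} {b : T.A}

theorem reindex_ρ (h : S.Realizes R β) (h' : T.Realizes R β') (hab : (β a).reindex e = β' b)
    (i : S.I) : (β (S.ρ i a)).reindex e = β' (T.ρ (e i) b) := by
  have hstep := (h.isStep a i).reindex e
  rw [hab] at hstep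
  exact hstep.unique (h'.isStep b (e i)) ((h.rootBasis _).reindex e) (h'.rootBasis _)

theorem C_eq_of_reindex_eq (h : S.Realizes R β) (h' : T.Realizes R β')
    (hab : (β a).reindex e = β' b) (i j : S.I) : T.C b (e i) (e j) = S.C a i j := by
  have happly (k : S.I) : β' b (e k) = β a k := by simp [← hab]
  have hj : β' (T.ρ (e i) b) (e j) = β (S.ρ i a) j := by simp [← h.reindex_ρ h' hab i]
  rw [h.step, h'.step, happly, happly, sub_right_inj, ← Int.cast_smul_eq_zsmul 𝕜,
    ← Int.cast_smul_eq_zsmul 𝕜] at hj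
  exact Int.cast_injective (smul_left_injective 𝕜 ((β a).ne_zero i) hj)

theorem exists_reindex_eq (h : S.Realizes R β) (h' : T.Realizes R β') (hc : S.IsConnected)
    (hab : (β a).reindex e = β' b) (c : S.A) : ∃ d, (β c).reindex e = β' d := by
  obtain ⟨w, hw⟩ := hc a c
  induction hw with
  | id => exact ⟨b, hab⟩
  | comp _ _ i _ ih =>
    obtain ⟨d, hd⟩ := ih
    exact ⟨_, h.reindex_ρ h' hd i⟩

theorem equivalent_of_reindex_eq (h : S.Realizes R β) (hc : S.IsConnected)
    (hβ : Function.Injective β) (h' : T.Realizes R β') (hc' : T.IsConnected)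
    (hβ' : Function.Injective β') (hab : (β a).reindex e = β' b) : S.Equivalent T := by
  choose φ hφ using h.exists_reindex_eq h' hc hab
  have hφ_eq {c : S.A} {d : T.A} (hcd : (β c).reindex e = β' d) : φ c = d :=
    hβ' ((hφ c).symm.trans hcd)
  have reindex_symm {c : S.A} {d : T.A} :
      (β' d).reindex e.symm = β c ↔ (β c).reindex e = β' d := by
    constructor <;> intro hcd <;> rw [← hcd] <;> ext <;> simp
  have hbij : Function.Bijective φ := by
    refine ⟨fun c c' hcc => hβ ?_, fun d => ?_⟩
    · rw [← reindex_symm.2 (hφ c), hcc, reindex_symm.2 (hφ c')]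
    · obtain ⟨c, hcd⟩ := h'.exists_reindex_eq h hc' (reindex_symm.2 hab) d
      exact ⟨c, hφ_eq (reindex_symm.1 hcd)⟩
  exact ⟨e, Equiv.ofBijective φ hbij, fun i c => hφ_eq (h.reindex_ρ h' (hφ c) i),
    fun i j c => h.C_eq_of_reindex_eq h' (hφ c) i j⟩

end SameRoots

variable {R' : Set W'} {β' : T.A → Basis T.I 𝕜 W'}

theorem equivalent (h : S.Realizes R β) [Nonempty S.A] (hc : S.IsConnected)
    (hβ : Function.Injective β) (h' : T.Realizes R' β') [Nonempty T.A] (hc' : T.IsConnected)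
    (hβ' : Function.Injective β') {ψ : W ≃ₗ[𝕜] W'} (hψ : ψ '' R = R') : S.Equivalent T := by
  subst hψ
  obtain ⟨b⟩ := ‹Nonempty T.A›
  obtain ⟨a, ha⟩ := (h.map ψ).exists_range_eq (h'.rootBasis b)
  obtain ⟨e, he⟩ := exists_reindex_eq_of_range_eq ha
  refine (h.map ψ).equivalent_of_reindex_eq hc (fun c d hcd => hβ ?_) h' hc' hβ' he
  ext i
  exact ψ.injective (by simpa using congr($hcd i))

theorem exists_linearEquiv (h : S.Realizes R β) [Nonempty S.A] (hc : S.IsConnected)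
    (h' : T.Realizes R' β') (hc' : T.IsConnected) (hST : S.Equivalent T) :
    ∃ ψ : W ≃ₗ[𝕜] W', ψ '' R = R' := by
  obtain ⟨φ₀, φ₁, hρ, hC⟩ := hST
  obtain ⟨a₀⟩ := ‹Nonempty S.A›
  have : Nonempty T.A := ⟨φ₁ a₀⟩
  let ψ := (β a₀).equiv (β' (φ₁ a₀)) φ₀
  have hψ (a : S.A) : ∀ j, ψ (β a j) = β' (φ₁ a) (φ₀ j) := by
    obtain ⟨w, hw⟩ := hc a₀ a
    induction hw with
    | id => exact fun j => by simp [ψ]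
    | comp a _ i _ ih => exact fun j => by rw [h.step, hρ, h'.step, map_sub, map_zsmul, ih, ih, hC]
  refine ⟨ψ, Set.ext fun y => ?_⟩
  simp only [Set.mem_image, h.mem_iff hc, h'.mem_iff hc']
  constructor
  · rintro ⟨_, ⟨a, j, rfl⟩, rfl⟩
    exact ⟨φ₁ a, φ₀ j, (hψ a j).symm⟩
  · rintro ⟨b, j, rfl⟩
    exact ⟨_, ⟨φ₁.symm b, φ₀.symm j, rfl⟩, by simp [hψ]⟩

end Realizes

end CartanQuadruple

/-! ### Schemes of finite type have injective realizations -/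

theorem RootBasis.exists_ofCoords_eq_comp {𝕜 W ι : Type*} [Field 𝕜] [AddCommGroup W] [Module 𝕜 W]
    [Fintype ι] (b : Basis ι 𝕜 W) {f : (ι → ℤ) →ₗ[ℤ] (ι → ℤ)} (hf : Function.Surjective f) :
    ∃ b' : Basis ι 𝕜 W, ofCoords b' = ofCoords b ∘ₗ f := by
  classical
  let v (j : ι) : W := ofCoords b (f (Pi.single j 1))
  have hv : Fintype.linearCombination ℤ v = ofCoords b ∘ₗ f :=
    (Pi.basisFun ℤ ι).ext fun j => by simp [v]
  have hspan : ⊤ ≤ Submodule.span 𝕜 (Set.range v) := by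
    rw [← b.span_eq, Submodule.span_le]
    rintro _ ⟨i, rfl⟩
    obtain ⟨x, hx⟩ := hf (Pi.single i 1)
    have hbi : ∑ j, x j • v j = b i := by
      rw [← Fintype.linearCombination_apply, hv, LinearMap.comp_apply, hx, ofCoords_single]
    rw [← hbi]
    exact sum_mem fun j _ => zsmul_mem (Submodule.subset_span (Set.mem_range_self j)) _
  have hcard : Fintype.card ι = finrank 𝕜 W := (finrank_eq_card_basis b).symm
  refine ⟨basisOfTopLeSpanOfCardEqFinrank v hspan hcard, ?_⟩
  rw [ofCoords, coe_basisOfTopLeSpanOfCardEqFinrank, hv]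

namespace CartanQuadruple

open RootBasis

variable {S : CartanQuadruple.{u, v}}

theorem s_simpleRoot (a : S.A) (i j : S.I) :
    S.s a i (S.simpleRoot j) = S.simpleRoot j - S.C a i j • S.simpleRoot i := by
  have h := (Pi.basisFun ℤ S.I).constr_basis ℤ
    (fun j => S.simpleRoot j - S.C a i j • S.simpleRoot i) j
  rwa [Pi.basisFun_apply] at h

theorem IsMorphism.trans {a b c : S.A} {w w'} (h : S.IsMorphism a b w)
    (h' : S.IsMorphism b c w') : S.IsMorphism a c (w' ∘ₗ w) := by
  induction h' with
  | id => exact h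
  | comp c _ i _ ih => exact ih.comp c _ i

theorem IsMorphism.apply_mem_realRoots {a b : S.A} {w} (h : S.IsMorphism a b w) {x : S.I → ℤ}
    (hx : x ∈ S.realRoots a) : w x ∈ S.realRoots b := by
  obtain ⟨c, w', j, hw', rfl⟩ := hx
  exact ⟨c, _, j, hw'.trans h, rfl⟩

theorem isMorphism_s (hρ : ∀ i a, S.ρ i (S.ρ i a) = a) (a : S.A) (i : S.I) :
    S.IsMorphism (S.ρ i a) a (S.s (S.ρ i a) i) := by
  simpa only [hρ, LinearMap.comp_id] using (IsMorphism.id (S := S)).comp (S.ρ i a) _ i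

theorem IsMorphism.exists_symm (hρ : ∀ i a, S.ρ i (S.ρ i a) = a) {a b : S.A} {w}
    (h : S.IsMorphism a b w) : ∃ w', S.IsMorphism b a w' := by
  induction h with
  | id => exact ⟨_, .id⟩
  | comp b _ i _ ih =>
    obtain ⟨_, hw'⟩ := ih
    exact ⟨_, (isMorphism_s hρ b i).trans hw'⟩

theorem isConnected_of_forall_exists_isMorphism (hρ : ∀ i a, S.ρ i (S.ρ i a) = a) (a₀ : S.A)
    (h : ∀ b, ∃ w, S.IsMorphism a₀ b w) : S.IsConnected := by
  intro a b
  obtain ⟨_, hw⟩ := h a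
  obtain ⟨_, hw'⟩ := hw.exists_symm hρ
  obtain ⟨_, hw''⟩ := h b
  exact ⟨_, hw'.trans hw''⟩

namespace IsFiniteType

theorem apply_apply (hS : S.IsFiniteType) {a b : S.A} {w w'} (h : S.IsMorphism a b w)
    (h' : S.IsMorphism b a w') (x : S.I → ℤ) : w' (w x) = x :=
  LinearMap.congr_fun (hS.simplyConnected a _ (h.trans h')) x

theorem morphism_unique (hS : S.IsFiniteType) {a b : S.A} {w w'} (h : S.IsMorphism a b w)
    (h' : S.IsMorphism a b w') : w = w' := by
  obtain ⟨w'', hw''⟩ := hS.connected b a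
  refine LinearMap.ext fun x => ?_
  rw [← hS.apply_apply hw'' h (w' x), hS.apply_apply h' hw'']

variable {𝕜 W : Type*} [Field 𝕜] [AddCommGroup W] [Module 𝕜 W]

theorem eq_one_or_eq_neg_one_of_smul_mem [CharZero 𝕜] (hS : S.IsFiniteType) {a : S.A}
    {b : Basis S.I 𝕜 W} {i : S.I} {t : 𝕜} (ht : t • b i ∈ ofCoords b '' S.realRoots a) :
    t = 1 ∨ t = -1 := by
  obtain ⟨x, hx, hxt⟩ := ht
  have hcoord (k : S.I) : (x k : 𝕜) = t * b.repr (b i) k := by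
    rw [← repr_ofCoords b, hxt, map_smul, Finsupp.smul_apply, smul_eq_mul]
  have hxi : (x i : 𝕜) = t := by simp [hcoord]
  have hx_eq : x = x i • S.simpleRoot i := by
    ext k
    by_cases hk : k = i
    · simp [hk, simpleRoot]
    · have hxk : (x k : 𝕜) = 0 := by simp [hcoord, Ne.symm hk]
      simp [simpleRoot, hk, Int.cast_eq_zero.1 hxk]
  have hxi' : x i = 1 ∨ x i = -1 := by
    have hi : S.simpleRoot i i = 1 := Pi.single_eq_same i 1
    rcases (hS.rootSystem.R2 a i).subset ⟨hx, x i, hx_eq⟩ with h | h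
    · exact .inl ((congrFun h i).trans hi)
    · exact .inr ((congrFun h i).trans (congrArg Neg.neg hi))
  rw [← hxi]
  exact_mod_cast hxi'

theorem isReducedSet_image_realRoots (hS : S.IsFiniteType) (a : S.A) {b : Basis S.I 𝕜 W}
    (h : ∀ x ∈ ofCoords b '' S.realRoots a, ∀ t : 𝕜, t • x ∈ ofCoords b '' S.realRoots a →
      t = 1 ∨ t = -1) : IsReducedSet 𝕜 (ofCoords b '' S.realRoots a) where
  finite := (hS.finite a).image _
  neg_mem := by
    rintro _ ⟨x, hx, rfl⟩
    refine ⟨-x, ?_, map_neg _ x⟩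
    rw [hS.rootSystem.R1 a] at hx ⊢
    rcases hx with hx | hx
    · exact .inr (by simpa using hx)
    · exact .inl hx
  reduced := h

variable [LinearOrder 𝕜] [IsStrictOrderedRing 𝕜]

theorem isRootBasis_image_realRoots (hS : S.IsFiniteType) (a : S.A) (b : Basis S.I 𝕜 W) :
    IsRootBasis (ofCoords b '' S.realRoots a) b where
  mem i := ⟨S.simpleRoot i, ⟨a, _, i, .id, rfl⟩, ofCoords_single b i⟩
  integral := by
    rintro _ ⟨x, -, rfl⟩ i
    exact ⟨x i, repr_ofCoords b x i⟩
  pos_or_neg := by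
    rintro _ ⟨x, hx, rfl⟩
    rw [← map_neg, isPos_ofCoords, isPos_ofCoords]
    rw [hS.rootSystem.R1 a] at hx
    exact hx.imp And.right And.right

/-- Morphisms to a fixed object `a₀` transport the standard bases at all objects to `a₀`. -/
theorem exists_realizes (hS : S.IsFiniteType) (b : Basis S.I 𝕜 W) :
    ∃ (R : Set W) (β : S.A → Basis S.I 𝕜 W), S.Realizes R β := by
  obtain ⟨a₀⟩ := hS.scheme.nonempty_A
  choose w hw using fun a => hS.connected a a₀
  choose w' hw' using hS.connected a₀
  choose β hβ using fun a => exists_ofCoords_eq_comp b (f := w a) fun x =>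
    ⟨w' a x, hS.apply_apply (hw' a) (hw a) x⟩
  have hβ_apply (a : S.A) (x : S.I → ℤ) : ofCoords (β a) x = ofCoords b (w a x) :=
    LinearMap.congr_fun (hβ a) x
  have hβ_simple (a : S.A) (j : S.I) : β a j = ofCoords b (w a (S.simpleRoot j)) := by
    rw [← hβ_apply, simpleRoot, ofCoords_single]
  have himage (a : S.A) : ofCoords (β a) '' S.realRoots a = ofCoords b '' S.realRoots a₀ := by
    rw [hβ, LinearMap.coe_comp, Set.image_comp]
    congr 1
    refine Set.Subset.antisymm ?_ fun x hx =>
      ⟨w' a x, (hw' a).apply_mem_realRoots hx, hS.apply_apply (hw' a) (hw a) x⟩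
    rintro _ ⟨x, hx, rfl⟩
    exact (hw a).apply_mem_realRoots hx
  refine ⟨ofCoords b '' S.realRoots a₀, β, hS.isReducedSet_image_realRoots a₀ ?_,
    fun a => himage a ▸ hS.isRootBasis_image_realRoots a (β a),
    fun a => (hS.scheme.cartan a).diag, fun a i j => ?_⟩
  · rintro _ ⟨_, ⟨c, u, j, hu, rfl⟩, rfl⟩ t ht
    rw [hS.morphism_unique hu (hw c), ← hβ_simple, ← himage c] at ht
    exact hS.eq_one_or_eq_neg_one_of_smul_mem ht
  · have hwi : w (S.ρ i a) = w a ∘ₗ S.s (S.ρ i a) i :=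
      hS.morphism_unique (hw _) ((isMorphism_s hS.scheme.ρ_ρ a i).trans (hw a))
    rw [hβ_simple, hwi, LinearMap.comp_apply, s_simpleRoot, ← hS.scheme.C_ρ, map_sub, map_sub,
      map_zsmul, map_zsmul, ← hβ_simple, ← hβ_simple]

end IsFiniteType

variable {𝕜 W : Type*} [Field 𝕜] [LinearOrder 𝕜] [AddCommGroup W] [Module 𝕜 W]

/-- The objects that are reached from `a₀` by crossing only hyperplanes that have `a₀` on the
same side, that is, without ever reducing the distance from `a₀`. -/
inductive AscentReachable (S : CartanQuadruple.{u, v}) (β : S.A → Basis S.I 𝕜 W) (a₀ : S.A) :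
    S.A → Prop
  | base : AscentReachable S β a₀ a₀
  | step (a : S.A) (i : S.I) (h : AscentReachable S β a₀ a) (hi : IsPos (β a₀) (β a i)) :
      AscentReachable S β a₀ (S.ρ i a)

namespace Realizes

variable [IsStrictOrderedRing 𝕜] {R : Set W} {β : S.A → Basis S.I 𝕜 W}

theorem alternatingWalk_full (h : S.Realizes R β) (hS : S.IsFiniteType) (a : S.A) {i j : S.I}
    (hij : i ≠ j) : S.alternatingWalk j i a (2 * (planeRoots R (β a) i j).ncard) = a := by
  have : Nonempty S.A := ⟨a⟩
  rw [← iterate_eq_alternatingWalk, ← h.ncard_plane hS.connected a hij]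
  exact hS.rootSystem.R4 a i j hij ((hS.finite a).subset fun _ hx => hx.1)

theorem ncard_planeRoots_pos (h : S.Realizes R β) (a : S.A) (i j : S.I) :
    0 < (planeRoots R (β a) i j).ncard := by
  refine (Set.ncard_pos (finite_planeRoots h.reduced _ _ _)).2
    ⟨β a i, (h.rootBasis a).mem i, isPos_self _ _, fun k hk _ => ?_⟩
  simp [hk.symm]

/-- The rank two relation replaces the descent from `S.ρ j c` in the direction `i` by an
alternating walk through objects that are closer to `a₀`. -/
theorem ascentReachable_ρ_ρ (h : S.Realizes R β) (hS : S.IsFiniteType) {a₀ c : S.A} {i j : S.I}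
    (hij : i ≠ j) (hc : S.AscentReachable β a₀ c) (hj : IsPos (β a₀) (β c j))
    (hi : ¬IsPos (β a₀) (β (S.ρ j c) i))
    (ih : ∀ a, (inversions R (β a₀) (β a)).ncard < (inversions R (β a₀) (β (S.ρ j c))).ncard →
      S.AscentReachable β a₀ a → ∀ k, S.AscentReachable β a₀ (S.ρ k a)) :
    S.AscentReachable β a₀ (S.ρ i (S.ρ j c)) := by
  set a := S.ρ j c
  set m := (planeRoots R (β a) i j).ncard with hm
  have hi_neg : IsPos (β a₀) (-β a i) :=
    ((h.rootBasis a₀).isPos_neg_iff h.reduced ((h.rootBasis a).mem i)).2 hi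
  have hj_neg : IsPos (β a₀) (-β a j) := by rwa [(h.isStep c j).apply_self, neg_neg]
  have hwalk (n : ℕ) (hn : n + 1 < 2 * m) :
      S.AscentReachable β a₀ (S.alternatingWalk j i a (n + 1)) := by
    induction n with
    | zero =>
      have hback : S.alternatingWalk j i a 1 = c := hS.scheme.ρ_ρ j c
      rwa [zero_add, hback]
    | succ n ihn =>
      exact ih _ ((h.isAlternatingWalk a hij).ncard_inversions_lt h.reduced hi_neg hj_neg
        n.succ_pos (show n + 1 < 2 * m by lia)) (ihn (by lia)) _
  have hm_pos : 0 < m := h.ncard_planeRoots_pos a i j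
  obtain ⟨n, hn⟩ : ∃ n, m = n + 1 := ⟨m - 1, by lia⟩
  have hlast : S.ρ i (S.alternatingWalk j i a (2 * n + 1)) = a := by
    have hfull := h.alternatingWalk_full hS a hij
    rw [← hm, hn, mul_add_one, alternatingWalk] at hfull
    simpa [alternating] using hfull
  rw [← hlast, hS.scheme.ρ_ρ]
  exact hwalk _ (by lia)

theorem ascentReachable_ρ (h : S.Realizes R β) (hS : S.IsFiniteType) {a₀ a : S.A}
    (ha : S.AscentReachable β a₀ a) (i : S.I) : S.AscentReachable β a₀ (S.ρ i a) := by
  induction hn : (inversions R (β a₀) (β a)).ncard using Nat.strong_induction_on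
    generalizing a i with
  | _ n ih =>
    subst hn
    by_cases hi : IsPos (β a₀) (β a i)
    · exact .step a i ha hi
    cases ha with
    | base => exact absurd (isPos_self _ i) hi
    | step c j hc hj =>
      rcases eq_or_ne i j with rfl | hij
      · rwa [hS.scheme.ρ_ρ]
      · exact h.ascentReachable_ρ_ρ hS hij hc hj hi fun a ha hreach k => ih _ ha hreach k rfl

theorem ascentReachable (h : S.Realizes R β) (hS : S.IsFiniteType) (a₀ a : S.A) :
    S.AscentReachable β a₀ a := by
  obtain ⟨w, hw⟩ := hS.connected a₀ a
  induction hw with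
  | id => exact .base
  | comp _ _ i _ ih => exact h.ascentReachable_ρ hS ih i

theorem injective (h : S.Realizes R β) (hS : S.IsFiniteType) : Function.Injective β := by
  intro a₀ a hβ
  suffices ∀ c, S.AscentReachable β a₀ c → ∀ d, β c = β d → c = d from this a₀ .base a hβ
  intro c hc
  induction hc with
  | base =>
    intro d hd
    cases h.ascentReachable hS a₀ d with
    | base => rfl
    | step c j _ hj => exact absurd (hd ▸ hj) (h.isStep c j).not_isPos
  | step c j _ _ ih =>
    intro d hd
    have hstep : IsStep (β (S.ρ j c)) j (β (S.ρ j d)) := hd ▸ h.isStep d j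
    rw [ih (S.ρ j d) ((h.isStep c j).symm.unique hstep (h.rootBasis c) (h.rootBasis _)),
      hS.scheme.ρ_ρ]

end Realizes

end CartanQuadruple

/-! ### Chambers and simple systems -/

namespace Arrangement

open RootBasis Topology

section Algebra

variable {𝕜 V ι κ : Type*} [Field 𝕜] [AddCommGroup V] [Module 𝕜 V]

theorem apply_eq_sum_repr [Fintype ι] (b : Basis ι 𝕜 (Dual 𝕜 V)) (x : Dual 𝕜 V) (v : V) :
    x v = ∑ i, b.repr x i * b i v := by
  conv_lhs => rw [← b.sum_repr x]
  simp only [LinearMap.sum_apply, LinearMap.smul_apply, smul_eq_mul]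

theorem ker_injective (b : Basis ι 𝕜 (Dual 𝕜 V)) : Function.Injective fun i => (b i).ker := by
  classical
  intro i j h
  by_contra hij
  have hspan : b i ∈ Submodule.span 𝕜 {b j} := by
    simpa using mem_span_of_iInf_ker_le_ker (L := fun _ : Unit => b j) (K := b i)
      (by simpa using h.ge)
  obtain ⟨c, hc⟩ := Submodule.mem_span_singleton.1 hspan
  simpa [hij] using congr(b.repr $hc i)

variable [LinearOrder 𝕜]

/-- The open cone on which all members of `b` are positive. -/
def posCone (b : Basis ι 𝕜 (Dual 𝕜 V)) : Set V := {v | ∀ i, 0 < b i v}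

theorem posCone_eq_of_range_eq {b : Basis ι 𝕜 (Dual 𝕜 V)} {b' : Basis κ 𝕜 (Dual 𝕜 V)}
    (h : Set.range b = Set.range b') : posCone b = posCone b' := by
  ext v
  simpa [posCone] using congr(∀ x ∈ $h, 0 < x v)

variable [IsStrictOrderedRing 𝕜] {b : Basis ι 𝕜 (Dual 𝕜 V)} {x : Dual 𝕜 V} {v : V}

theorem apply_nonneg_of_isPos [Finite ι] (hx : IsPos b x) (hv : ∀ i, 0 ≤ b i v) : 0 ≤ x v := by
  cases nonempty_fintype ι
  rw [apply_eq_sum_repr b]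
  exact Finset.sum_nonneg fun i _ => mul_nonneg (hx i) (hv i)

theorem apply_pos_of_isPos [Finite ι] (hx : IsPos b x) (hx0 : x ≠ 0) (hv : v ∈ posCone b) :
    0 < x v := by
  cases nonempty_fintype ι
  obtain ⟨j, hj⟩ := hx.exists_repr_pos hx0
  rw [apply_eq_sum_repr b]
  exact Finset.sum_pos' (fun i _ => mul_nonneg (hx i) (hv i).le)
    ⟨j, Finset.mem_univ j, mul_pos hj (hv j)⟩

variable {R : Set (Dual 𝕜 V)}

theorem apply_ne_zero_of_isSimpleSystem [Finite ι] (hR : IsReducedSet 𝕜 R)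
    (hb : IsSimpleSystem R b) (hv : v ∈ posCone b) (hx : x ∈ R) : x v ≠ 0 := by
  have hx0 := hR.ne_zero hx
  rcases hb.pos_or_neg x hx with h | h
  · exact (apply_pos_of_isPos h hx0 hv).ne'
  · simpa using (apply_pos_of_isPos h (neg_ne_zero.2 hx0) hv).ne'

theorem isPos_iff_apply_pos [Finite ι] (hR : IsReducedSet 𝕜 R) (hb : IsSimpleSystem R b)
    (hv : v ∈ posCone b) (hx : x ∈ R) : IsPos b x ↔ 0 < x v := by
  refine ⟨fun h => apply_pos_of_isPos h (hR.ne_zero hx) hv, fun h => ?_⟩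
  refine (hb.pos_or_neg x hx).resolve_right fun hn => h.not_ge ?_
  simpa using apply_nonneg_of_isPos hn fun i => (hv i).le

end Algebra

section Predual

variable {𝕜 V ι : Type*} [Field 𝕜] [AddCommGroup V] [Module 𝕜 V] [FiniteDimensional 𝕜 V]
  [Finite ι] [DecidableEq ι]

/-- The basis of the space that is dual to a basis of the dual space. -/
def predual (b : Basis ι 𝕜 (Dual 𝕜 V)) : Basis ι 𝕜 V := b.dualBasis.map (evalEquiv 𝕜 V).symm

theorem apply_predual (b : Basis ι 𝕜 (Dual 𝕜 V)) (x : Dual 𝕜 V) (i : ι) :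
    x (predual b i) = b.repr x i := by
  rw [predual, Basis.map_apply, apply_evalEquiv_symm_apply, Basis.coe_dualBasis, Basis.coord_apply]

theorem repr_predual (b : Basis ι 𝕜 (Dual 𝕜 V)) (v : V) (i : ι) :
    (predual b).repr v i = b i v := by
  suffices (predual b).coord i = b i from LinearMap.congr_fun this v
  refine (predual b).ext fun j => ?_
  rw [Basis.coord_apply, Basis.repr_self, apply_predual, Basis.repr_self, Finsupp.single_apply,
    Finsupp.single_apply]
  exact if_congr eq_comm rfl rfl

theorem sum_apply_smul_predual [Fintype ι] (b : Basis ι 𝕜 (Dual 𝕜 V)) (v : V) :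
    ∑ i, b i v • predual b i = v := by
  simpa only [repr_predual] using (predual b).sum_repr v

theorem span_eq_ker {b : Basis ι 𝕜 (Dual 𝕜 V)} {i : ι} {s : Set V} (hs : s ⊆ (b i).ker)
    (hb : ∀ j, j ≠ i → predual b j ∈ s) : Submodule.span 𝕜 s = (b i).ker := by
  cases nonempty_fintype ι
  refine (Submodule.span_le.2 hs).antisymm fun v hv => ?_
  rw [← sum_apply_smul_predual b v]
  refine Submodule.sum_mem _ fun j _ => ?_
  by_cases hj : j = i
  · rw [hj, LinearMap.mem_ker.1 hv, zero_smul]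
    exact Submodule.zero_mem _
  · exact Submodule.smul_mem _ _ (Submodule.subset_span (hb j hj))

theorem sum_predual_mem_posCone [Fintype ι] [LinearOrder 𝕜] [IsStrictOrderedRing 𝕜]
    (b : Basis ι 𝕜 (Dual 𝕜 V)) : ∑ j, predual b j ∈ posCone b := fun i => by
  simp [apply_predual, Finsupp.single_apply]

end Predual

theorem convex_posCone {V ι : Type*} [AddCommGroup V] [Module ℝ V] (b : Basis ι ℝ (Dual ℝ V)) :
    Convex ℝ (posCone b) := by
  rw [posCone, Set.ofPred_forall]
  exact convex_iInter fun i => convex_halfSpace_gt (b i).isLinear 0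

section Closure

variable {V ι : Type*} [AddCommGroup V] [Module ℝ V] [TopologicalSpace V]
  [IsTopologicalAddGroup V] [ContinuousSMul ℝ V] [T2Space V] [FiniteDimensional ℝ V]

theorem apply_pos_of_isPreconnected {K : Set V} (hK : IsPreconnected K) {x : Dual ℝ V}
    (hx : ∀ v ∈ K, x v ≠ 0) {u v : V} (hu : u ∈ K) (hv : v ∈ K) (h : 0 < x u) : 0 < x v := by
  by_contra! hn
  obtain ⟨w, hw, h0⟩ := hK.intermediate_value hv hu
    x.continuous_of_finiteDimensional.continuousOn ⟨hn, h.le⟩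
  exact hx w hw h0

variable [Finite ι]

theorem closure_posCone (b : Basis ι ℝ (Dual ℝ V)) :
    closure (posCone b) = {v | ∀ i, 0 ≤ b i v} := by
  classical
  cases nonempty_fintype ι
  refine (closure_minimal (fun v hv i => (hv i).le) ?_).antisymm fun v hv => ?_
  · rw [Set.ofPred_forall]
    exact isClosed_iInter fun i =>
      isClosed_le continuous_const (b i).continuous_of_finiteDimensional
  · have hcont : Continuous fun t : ℝ => v + t • ∑ j, predual b j := by fun_prop
    have ht := (hcont.tendsto 0).mono_left (nhdsWithin_le_nhds (s := Set.Ioi 0))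
    rw [zero_smul, add_zero] at ht
    refine mem_closure_of_tendsto ht ?_
    filter_upwards [self_mem_nhdsWithin] with t ht i
    rw [map_add, map_smul]
    exact add_pos_of_nonneg_of_pos (hv i) (mul_pos ht (sum_predual_mem_posCone b i))

theorem predual_mem_closure [DecidableEq ι] (b : Basis ι ℝ (Dual ℝ V)) (j : ι) :
    predual b j ∈ closure (posCone b) := by
  rw [closure_posCone]
  intro i
  rw [apply_predual, Basis.repr_self, Finsupp.single_apply]
  split_ifs <;> norm_num

theorem isPos_iff_forall_posCone {b : Basis ι ℝ (Dual ℝ V)} {x : Dual ℝ V} :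
    IsPos b x ↔ ∀ v ∈ posCone b, 0 ≤ x v := by
  classical
  refine ⟨fun h v hv => apply_nonneg_of_isPos h fun i => (hv i).le, fun h i => ?_⟩
  rw [← apply_predual]
  exact closure_minimal (t := {v | 0 ≤ x v}) h
    (isClosed_le continuous_const x.continuous_of_finiteDimensional) (predual_mem_closure b i)

variable {R : Set (Dual ℝ V)} {b : Basis ι ℝ (Dual ℝ V)}

theorem exists_apply_neg_of_isSimpleSystem (hR : IsReducedSet ℝ R) (hb : IsSimpleSystem R b)
    (i : ι) : ∃ v, b i v < 0 ∧ ∀ x ∈ R, IsPos b x → x ≠ b i → 0 < x v := by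
  classical
  cases nonempty_fintype ι
  -- A point just behind the centre `p` of the facet `ker (b i)`.
  let p := ∑ j ∈ Finset.univ.erase i, predual b j
  let v (t : ℝ) := p - t • predual b i
  have hp (x : Dual ℝ V) : x p = ∑ j ∈ Finset.univ.erase i, b.repr x j := by
    simp only [p, map_sum, apply_predual]
  have hpos : ∀ x ∈ {x ∈ R | IsPos b x ∧ x ≠ b i}, ∀ᶠ t in 𝓝[>] 0, 0 < x (v t) := by
    rintro x ⟨hx, hpos, hne⟩
    obtain ⟨j, hji, hj⟩ := hR.exists_repr_pos_of_ne (hb.mem i) hx hpos hne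
    have hxp : 0 < x (v 0) := by
      rw [show v 0 = p by simp [v], hp]
      exact Finset.sum_pos' (fun k _ => hpos k) ⟨j, by simpa using hji, hj⟩
    have hcont : Continuous fun t => x (v t) :=
      x.continuous_of_finiteDimensional.comp (by fun_prop)
    exact nhdsWithin_le_nhds (hcont.continuousAt.eventually_const_lt hxp)
  have hfin : {x ∈ R | IsPos b x ∧ x ≠ b i}.Finite := hR.finite.subset fun x hx => hx.1
  obtain ⟨t, ht, ht0⟩ := (((Filter.eventually_all_finite hfin).2 hpos).and
    self_mem_nhdsWithin).exists
  refine ⟨v t, ?_, fun x hx hpos hne => ht x ⟨hx, hpos, hne⟩⟩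
  have hbi : b i p = 0 := by
    rw [hp]
    exact Finset.sum_eq_zero fun j hj => by simp [(Finset.ne_of_mem_erase hj).symm]
  simpa [v, hbi, apply_predual] using ht0

end Closure

section Chambers

variable {r : ℕ} {𝒜 : Set (Submodule ℝ (Fin r → ℝ))} {K K' : Set (Fin r → ℝ)} {v : Fin r → ℝ}

theorem subset_complement (hK : K ∈ chambers 𝒜) : K ⊆ complement 𝒜 := by
  obtain ⟨v, -, rfl⟩ := hK
  exact connectedComponentIn_subset _ _

theorem isPreconnected_of_mem_chambers (hK : K ∈ chambers 𝒜) : IsPreconnected K := by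
  obtain ⟨v, -, rfl⟩ := hK
  exact isPreconnected_connectedComponentIn

theorem nonempty_of_mem_chambers (hK : K ∈ chambers 𝒜) : K.Nonempty := by
  obtain ⟨v, hv, rfl⟩ := hK
  exact ⟨v, mem_connectedComponentIn hv⟩

theorem eq_connectedComponentIn (hK : K ∈ chambers 𝒜) (hv : v ∈ K) :
    K = connectedComponentIn (complement 𝒜) v := by
  obtain ⟨w, -, rfl⟩ := hK
  exact connectedComponentIn_eq hv

theorem chambers_eq_of_mem (hK : K ∈ chambers 𝒜) (hK' : K' ∈ chambers 𝒜) (hv : v ∈ K)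
    (hv' : v ∈ K') : K = K' :=
  (eq_connectedComponentIn hK hv).trans (eq_connectedComponentIn hK' hv').symm

theorem mem_of_mem_closure (hK : K ∈ chambers 𝒜) (hv : v ∈ closure K) (hv' : v ∈ complement 𝒜) :
    v ∈ K := by
  obtain ⟨w, hw⟩ := nonempty_of_mem_chambers hK
  have hpre : IsPreconnected (insert v K) := (isPreconnected_of_mem_chambers hK).subset_closure
    (Set.subset_insert v K) (Set.insert_subset hv subset_closure)
  rw [eq_connectedComponentIn hK hw]
  exact hpre.subset_connectedComponentIn (Set.mem_insert_of_mem v hw)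
    (Set.insert_subset hv' (subset_complement hK)) (Set.mem_insert v K)

theorem isOpenSimplicialCone_iff_repr :
    IsOpenSimplicialCone K ↔ ∃ e : Basis (Fin r) ℝ (Fin r → ℝ), K = {v | ∀ i, 0 < e.repr v i} := by
  refine exists_congr fun e => ?_
  suffices {v | ∃ a : Fin r → ℝ, (∀ i, 0 < a i) ∧ v = ∑ i, a i • e i} =
    {v | ∀ i, 0 < e.repr v i} by rw [this]
  ext v
  constructor
  · rintro ⟨a, ha, rfl⟩ i
    rw [e.repr_sum_self]
    exact ha i
  · exact fun h => ⟨e.repr v, h, (e.sum_repr v).symm⟩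

theorem isOpenSimplicialCone_iff :
    IsOpenSimplicialCone K ↔ ∃ b : Basis (Fin r) ℝ (Dual ℝ (Fin r → ℝ)), K = posCone b := by
  rw [isOpenSimplicialCone_iff_repr]
  constructor
  · rintro ⟨e, rfl⟩
    exact ⟨e.dualBasis, by simp [posCone]⟩
  · rintro ⟨b, rfl⟩
    exact ⟨predual b, by simp only [repr_predual, posCone]⟩

variable {R : Set (Dual ℝ (Fin r → ℝ))} {ι : Type*} {b : Basis ι ℝ (Dual ℝ (Fin r → ℝ))}

/-- The kernels of the elements of `R`. -/
def hyperplanes (R : Set (Dual ℝ (Fin r → ℝ))) : Set (Submodule ℝ (Fin r → ℝ)) :=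
  {H | ∃ x ∈ R, H = x.ker}

theorem mem_complement_hyperplanes : v ∈ complement (hyperplanes R) ↔ ∀ x ∈ R, x v ≠ 0 := by
  constructor
  · exact fun h x hx => h _ ⟨x, hx, rfl⟩
  · rintro h _ ⟨x, hx, rfl⟩
    exact h x hx

theorem finrank_ker_add_one {x : Dual ℝ (Fin r → ℝ)} (hx : x ≠ 0) : finrank ℝ x.ker + 1 = r := by
  rw [Dual.finrank_ker_add_one_of_ne_zero hx, finrank_fin_fun]

theorem chambers_hyperplanes_nonempty (hR : IsReducedSet ℝ R) :
    (chambers (hyperplanes R)).Nonempty := by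
  classical
  have htop : (⊤ : Submodule ℝ (Fin r → ℝ)) ∉ hR.finite.toFinset.image LinearMap.ker := by
    intro h
    simp only [Finset.mem_image, Set.Finite.mem_toFinset, LinearMap.ker_eq_top] at h
    obtain ⟨x, hx, rfl⟩ := h
    exact hR.ne_zero hx rfl
  obtain ⟨v, hv⟩ := (Set.ne_univ_iff_exists_notMem _).1
    (Subspace.biUnion_ne_univ_of_top_notMem htop)
  exact ⟨_, v, mem_complement_hyperplanes.2 fun x hx hxv => hv (by simpa using ⟨x, hx, hxv⟩), rfl⟩

variable [Finite ι]

theorem posCone_mem_chambers (hR : IsReducedSet ℝ R) (hb : IsSimpleSystem R b) :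
    posCone b ∈ chambers (hyperplanes R) := by
  classical
  cases nonempty_fintype ι
  have hsub : posCone b ⊆ complement (hyperplanes R) := fun v hv =>
    mem_complement_hyperplanes.2 fun x hx => apply_ne_zero_of_isSimpleSystem hR hb hv hx
  have hp := sum_predual_mem_posCone b
  refine ⟨_, hsub hp, ((convex_posCone b).isPreconnected.subset_connectedComponentIn hp
    hsub).antisymm fun v hv i => ?_⟩
  refine apply_pos_of_isPreconnected isPreconnected_connectedComponentIn (fun w hw => ?_)
    (mem_connectedComponentIn (hsub hp)) hv (hp i)
  exact mem_complement_hyperplanes.1 (connectedComponentIn_subset _ _ hw) _ (hb.mem i)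

theorem span_ker_inter_closure_posCone (b : Basis ι ℝ (Dual ℝ (Fin r → ℝ))) (i : ι) :
    Submodule.span ℝ ((b i).ker ∩ closure (posCone b)) = (b i).ker := by
  classical
  exact span_eq_ker Set.inter_subset_left fun j hj =>
    ⟨by simp [apply_predual, hj.symm], predual_mem_closure b j⟩

theorem span_ker_inter_closure_posCone_le {x : Dual ℝ (Fin r → ℝ)} (hx : IsPos b x) {i : ι}
    (hi : 0 < b.repr x i) : Submodule.span ℝ (x.ker ∩ closure (posCone b)) ≤ (b i).ker := by
  cases nonempty_fintype ι
  rw [closure_posCone, Submodule.span_le]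
  rintro v ⟨hxv : x v = 0, hv⟩
  rw [apply_eq_sum_repr b, Finset.sum_eq_zero_iff_of_nonneg fun j _ => mul_nonneg (hx j) (hv j)]
    at hxv
  exact (mul_eq_zero.1 (hxv i (Finset.mem_univ i))).resolve_left hi.ne'

theorem base_posCone (hR : IsReducedSet ℝ R) (hb : IsSimpleSystem R b) :
    base (hyperplanes R) R (posCone b) = Set.range b := by
  ext x
  constructor
  · rintro ⟨hx, ⟨-, hrank⟩, hnonneg⟩
    have hpos := isPos_iff_forall_posCone.2 hnonneg
    have hker {i : ι} (hi : 0 < b.repr x i) :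
        Submodule.span ℝ (x.ker ∩ closure (posCone b)) = (b i).ker :=
      Submodule.eq_of_le_of_finrank_eq (span_ker_inter_closure_posCone_le hpos hi)
        (Nat.succ_injective (hrank.trans (finrank_ker_add_one (b.ne_zero i)).symm))
    obtain ⟨i, hi⟩ := hpos.exists_repr_pos (hR.ne_zero hx)
    by_contra hne
    obtain ⟨j, hji, hj⟩ := hR.exists_repr_pos_of_ne (hb.mem i) hx hpos fun h => hne ⟨i, h.symm⟩
    exact hji (ker_injective b ((hker hj).symm.trans (hker hi)))
  · rintro ⟨i, rfl⟩
    refine ⟨hb.mem i, ⟨⟨b i, hb.mem i, rfl⟩, ?_⟩, fun v hv => (hv i).le⟩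
    rw [span_ker_inter_closure_posCone, finrank_ker_add_one (b.ne_zero i)]

theorem isPos_or_isPos_neg_of_mem_chambers (hK : posCone b ∈ chambers (hyperplanes R))
    {x : Dual ℝ (Fin r → ℝ)} (hx : x ∈ R) : IsPos b x ∨ IsPos b (-x) := by
  have hne : ∀ v ∈ posCone b, x v ≠ 0 := fun v hv =>
    mem_complement_hyperplanes.1 (subset_complement hK hv) x hx
  obtain ⟨u, hu⟩ := nonempty_of_mem_chambers hK
  have hpre := isPreconnected_of_mem_chambers hK
  refine (hne u hu).lt_or_gt.symm.imp (fun h => ?_) fun h => ?_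
  · exact isPos_iff_forall_posCone.2 fun v hv =>
      (apply_pos_of_isPreconnected hpre hne hu hv h).le
  · refine isPos_iff_forall_posCone.2 fun v hv =>
      (apply_pos_of_isPreconnected hpre (fun w hw => ?_) hu hv ?_).le
    · simpa using hne w hw
    · simpa using h

theorem exists_smul_mem_of_mem_chambers (hR : IsReducedSet ℝ R)
    (hK : posCone b ∈ chambers (hyperplanes R)) (i : ι) : ∃ c : ℝ, 0 < c ∧ c • b i ∈ R := by
  classical
  cases nonempty_fintype ι
  let p := ∑ j ∈ Finset.univ.erase i, predual b j
  have hp (x : Dual ℝ (Fin r → ℝ)) : x p = ∑ j ∈ Finset.univ.erase i, b.repr x j := by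
    simp only [p, map_sum, apply_predual]
  have hbp (j : ι) : b j p = if j = i then 0 else 1 := by
    simp [hp, Finsupp.single_apply]
  have hpK : p ∉ posCone b := fun h => (h i).ne' (by rw [hbp, if_pos rfl])
  have hpc : p ∈ closure (posCone b) := by
    rw [closure_posCone]
    intro j
    rw [hbp]
    split_ifs <;> norm_num
  obtain ⟨x, hx, hxp, hpos⟩ : ∃ x ∈ R, x p = 0 ∧ IsPos b x := by
    have hc := mt (mem_of_mem_closure hK hpc) hpK
    rw [mem_complement_hyperplanes] at hc
    push Not at hc
    obtain ⟨x, hx, hxp⟩ := hc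
    rcases isPos_or_isPos_neg_of_mem_chambers hK hx with h | h
    · exact ⟨x, hx, hxp, h⟩
    · exact ⟨-x, hR.neg_mem x hx, by simp [hxp], h⟩
  have hzero (j : ι) (hj : j ≠ i) : b.repr x j = 0 := by
    rw [hp, Finset.sum_eq_zero_iff_of_nonneg fun k _ => hpos k] at hxp
    exact hxp j (by simpa using hj)
  have hxi : x = b.repr x i • b i := b.ext_elem fun j => by
    by_cases hj : j = i
    · simp [hj]
    · simp [hzero j hj, Ne.symm hj]
  obtain ⟨j, hj⟩ := hpos.exists_repr_pos (hR.ne_zero hx)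
  obtain rfl : j = i := by_contra fun hji => hj.ne' (hzero j hji)
  exact ⟨b.repr x j, hj, hxi ▸ hx⟩

theorem exists_isSimpleSystem_of_mem_chambers (hR : IsReducedSet ℝ R)
    (hK : K ∈ chambers (hyperplanes R)) (hcone : IsOpenSimplicialCone K) :
    ∃ b : Basis (Fin r) ℝ (Dual ℝ (Fin r → ℝ)), IsSimpleSystem R b ∧ K = posCone b := by
  obtain ⟨b, rfl⟩ := isOpenSimplicialCone_iff.1 hcone
  choose c hc hcR using exists_smul_mem_of_mem_chambers hR hK
  let b' := b.isUnitSMul fun i => (hc i).ne'.isUnit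
  have hb' (i : Fin r) : b' i = c i • b i := Basis.isUnitSMul_apply _ i
  have hcone' : posCone b' = posCone b := by
    ext v
    simp only [posCone, Set.mem_ofPred_eq, hb', LinearMap.smul_apply, smul_eq_mul,
      mul_pos_iff_of_pos_left (hc _)]
  refine ⟨b', ⟨fun i => hb' i ▸ hcR i, fun x hx => ?_⟩, hcone'.symm⟩
  exact isPos_or_isPos_neg_of_mem_chambers (hcone'.symm ▸ hK) hx

end Chambers

end Arrangement

/-! ### The Cartan scheme of a crystallographic arrangement -/

section BasisReflection

variable {r : ℕ} {W : Type*} [AddCommGroup W] [Module ℝ W]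

theorem basisReflection_apply (b : Basis (Fin r) ℝ W) (i : Fin r) (c : Fin r → ℕ) (j : Fin r) :
    basisReflection b i c (b j) = if j = i then -b i else b j + c j • b i :=
  b.constr_basis ℝ _ j

theorem isStep_basisReflection (b : Basis (Fin r) ℝ W) (i : Fin r) (c : Fin r → ℕ) :
    RootBasis.IsStep b i (b.map (basisReflection b i c)) where
  apply_self := by rw [Basis.map_apply, basisReflection_apply, if_pos rfl]
  apply_of_ne j hj := ⟨c j, by
    rw [Basis.map_apply, basisReflection_apply, if_neg hj, Nat.cast_smul_eq_nsmul]⟩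

theorem range_map_basisReflection (b : Basis (Fin r) ℝ W) (i : Fin r) (c : Fin r → ℕ) :
    Set.range (b.map (basisReflection b i c)) = basisReflection b i c '' Set.range b :=
  Set.range_comp (basisReflection b i c) b

theorem RootBasis.Crosses.exists_range_basisReflection_eq {κ : Type*} {R : Set W}
    {b : Basis (Fin r) ℝ W} {i : Fin r} {b' : Basis κ ℝ W} (h : Crosses R b i b')
    (hR : IsReducedSet ℝ R) (hb : IsRootBasis R b) (hb' : IsRootBasis R b') :
    ∃ c, Set.range (b.map (basisReflection b i c)) = Set.range b' := by
  choose! c hc using fun j => h.exists_add_nsmul_mem_range hR hb hb' (j := j)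
  refine ⟨c, range_eq_of_range_subset ?_⟩
  rintro _ ⟨j, rfl⟩
  rw [Basis.map_apply, basisReflection_apply]
  split_ifs with hj
  · exact h.neg_mem_range hR hb hb'
  · exact hc j hj

end BasisReflection

namespace CrystallographicArrangement

open RootBasis Arrangement

theorem 𝒜_eq_hyperplanes (X : CrystallographicArrangement) : X.𝒜 = hyperplanes X.R := X.𝒜_eq

theorem isReducedSet (X : CrystallographicArrangement) : IsReducedSet ℝ X.R where
  finite := X.finite_R
  neg_mem x hx := ((X.reduced x hx).symm.subset (by simp : -x ∈ ({x, -x} : Set _))).1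
  reduced x hx t ht := by
    have hx0 : x ≠ 0 := by
      rintro rfl
      have h := X.simplicial.hyperplane (0 : Dual ℝ (Fin X.r → ℝ)).ker (X.𝒜_eq ▸ ⟨0, hx, rfl⟩)
      rw [LinearMap.ker_zero, finrank_top, finrank_fin_fun] at h
      omega
    refine ((X.reduced x hx).subset ⟨ht, t, rfl⟩).imp (fun h => ?_) fun h => ?_
    · exact smul_left_injective ℝ hx0 (h.trans (one_smul ℝ x).symm)
    · exact smul_left_injective ℝ hx0 (h.trans (neg_one_smul ℝ x).symm)

theorem nonempty_chambers (X : CrystallographicArrangement) : (chambers X.𝒜).Nonempty :=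
  X.𝒜_eq_hyperplanes ▸ chambers_hyperplanes_nonempty X.isReducedSet

variable {X : CrystallographicArrangement} {K : Set (Fin X.r → ℝ)}
  {b b' α : Basis (Fin X.r) ℝ (Dual ℝ (Fin X.r → ℝ))} {i : Fin X.r}

theorem base_posCone (hb : IsRootBasis X.R b) : base X.𝒜 X.R (posCone b) = Set.range b := by
  rw [X.𝒜_eq_hyperplanes, Arrangement.base_posCone X.isReducedSet hb.toIsSimpleSystem]

theorem posCone_mem_chambers (hb : IsRootBasis X.R b) : posCone b ∈ chambers X.𝒜 :=
  X.𝒜_eq_hyperplanes ▸ Arrangement.posCone_mem_chambers X.isReducedSet hb.toIsSimpleSystem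

theorem exists_isRootBasis (hK : K ∈ chambers X.𝒜) :
    ∃ b : Basis (Fin X.r) ℝ (Dual ℝ (Fin X.r → ℝ)), IsRootBasis X.R b ∧ K = posCone b := by
  have hcone := X.simplicial.cone K hK
  have hint := X.integral K hK
  rw [X.𝒜_eq_hyperplanes] at hK hint
  obtain ⟨b, hb, rfl⟩ := exists_isSimpleSystem_of_mem_chambers X.isReducedSet hK hcone
  rw [Arrangement.base_posCone X.isReducedSet hb] at hint
  exact ⟨b, ⟨hb, fun x hx i => ((b.mem_span_iff_repr_mem ℤ x).1 (hint hx) i).imp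
    fun n hn => hn.symm⟩, rfl⟩

theorem exists_isOrdering (hK : K ∈ chambers X.𝒜) : ∃ α, X.IsOrdering K α := by
  obtain ⟨b, hb, rfl⟩ := exists_isRootBasis hK
  exact ⟨b, (base_posCone hb).symm⟩

theorem isRootBasis_of_isOrdering (hK : K ∈ chambers X.𝒜) (hα : X.IsOrdering K α) :
    IsRootBasis X.R α ∧ K = posCone α := by
  obtain ⟨b, hb, rfl⟩ := exists_isRootBasis hK
  have hr : Set.range b = Set.range α := by rw [hα, base_posCone hb]
  exact ⟨hb.of_range_eq hr, posCone_eq_of_range_eq hr⟩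

theorem exists_crosses (hb : IsRootBasis X.R b) (i : Fin X.r) :
    ∃ b' : Basis (Fin X.r) ℝ (Dual ℝ (Fin X.r → ℝ)), IsRootBasis X.R b' ∧ Crosses X.R b i b' := by
  have hR := X.isReducedSet
  obtain ⟨v, hvi, hv⟩ := exists_apply_neg_of_isSimpleSystem hR hb.toIsSimpleSystem i
  have hne : ∀ x ∈ X.R, IsPos b x → x v ≠ 0 := fun x hx hpos => by
    by_cases hxi : x = b i
    · exact hxi ▸ hvi.ne
    · exact (hv x hx hpos hxi).ne'
  have hvc : v ∈ complement X.𝒜 := by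
    rw [X.𝒜_eq_hyperplanes, mem_complement_hyperplanes]
    intro x hx
    rcases hb.pos_or_neg x hx with h | h
    · exact hne x hx h
    · exact neg_ne_zero.1 (hne (-x) (hR.neg_mem x hx) h)
  obtain ⟨b', hb', hK⟩ := exists_isRootBasis ⟨v, hvc, rfl⟩
  have hvb' : v ∈ posCone b' := hK ▸ mem_connectedComponentIn hvc
  have hiff {x} (hx : x ∈ X.R) := isPos_iff_apply_pos hR hb'.toIsSimpleSystem hvb' hx
  exact ⟨b', hb', fun h => hvi.not_gt ((hiff (hb.mem i)).1 h),
    fun x hx hxi hpos => (hiff hx).2 (hv x hx hpos hxi)⟩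

theorem adjacent_of_isStep (hb : IsRootBasis X.R b) (hb' : IsRootBasis X.R b')
    (h : IsStep b i b') : Adjacent X.𝒜 (b i).ker (posCone b) (posCone b') := by
  refine ⟨posCone_mem_chambers hb, posCone_mem_chambers hb', fun heq => ?_, ?_⟩
  · exact h.not_isPos (isPos_iff_forall_posCone.2 fun v hv => (heq ▸ hv : v ∈ posCone b) i |>.le)
  refine span_eq_ker (fun v hv => ?_) fun j hj => ⟨predual_mem_closure b j, ?_⟩
  · rw [closure_posCone, closure_posCone] at hv
    have hneg := hv.2 i
    rw [h.apply_self, LinearMap.neg_apply, neg_nonneg] at hneg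
    exact hneg.antisymm (hv.1 i)
  · rw [closure_posCone]
    intro k
    rw [apply_predual, ← h.repr_eq hj]
    exact isPos_self b' k j

theorem crosses_of_adjacent (hb : IsRootBasis X.R b) (hb' : IsRootBasis X.R b')
    (h : Adjacent X.𝒜 (b i).ker (posCone b) (posCone b')) : Crosses X.R b i b' := by
  obtain ⟨-, -, hne, hspan⟩ := h
  have hpos : ∀ x ∈ X.R, x ≠ b i → IsPos b x → IsPos b' x := by
    intro x hx hxi hpos
    refine (hb'.pos_or_neg x hx).resolve_right fun hneg => ?_
    have hle : (b i).ker ≤ x.ker := by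
      rw [← hspan, Submodule.span_le, closure_posCone, closure_posCone]
      rintro v ⟨hv, hv'⟩
      exact (neg_nonneg.1 (apply_nonneg_of_isPos hneg hv')).antisymm (apply_nonneg_of_isPos hpos hv)
    obtain ⟨j, hji, hj⟩ := X.isReducedSet.exists_repr_pos_of_ne (hb.mem i) hx hpos hxi
    have hxj : x (predual b j) = 0 := hle (by simp [apply_predual, hji.symm])
    exact hj.ne' (by rw [← apply_predual, hxj])
  refine ⟨fun hi => hne (posCone_eq_of_range_eq ?_), hpos⟩
  refine (hb'.range_eq_of_forall_isPos hb fun k => ?_).symm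
  by_cases hk : k = i
  · rwa [hk]
  · exact hpos _ (hb.mem k) (b.injective.ne hk) (isPos_self b k)

theorem adjacent_nextChamber (hb : IsRootBasis X.R b) (i : Fin X.r) :
    Adjacent X.𝒜 (b i).ker (posCone b) (X.nextChamber (posCone b) (b i).ker) := by
  obtain ⟨b', hb', hcross⟩ := exists_crosses hb i
  obtain ⟨c, hc⟩ := hcross.exists_range_basisReflection_eq X.isReducedSet hb hb'
  exact Classical.epsilon_spec
    ⟨_, adjacent_of_isStep hb (hb'.of_range_eq hc.symm) (isStep_basisReflection b i c)⟩

theorem isRootBasis_coeff (hb : IsRootBasis X.R b) (i : Fin X.r) :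
    IsRootBasis X.R (b.map (basisReflection b i (X.coeff (posCone b) b i))) ∧
      X.nextChamber (posCone b) (b i).ker =
        posCone (b.map (basisReflection b i (X.coeff (posCone b) b i))) := by
  have hadj := adjacent_nextChamber hb i
  obtain ⟨b', hb', hK⟩ := exists_isRootBasis hadj.2.1
  have hbase : base X.𝒜 X.R (X.nextChamber (posCone b) (b i).ker) = Set.range b' := by
    rw [hK, base_posCone hb']
  obtain ⟨c, hc⟩ := (crosses_of_adjacent hb hb' (hK ▸ hadj)).exists_range_basisReflection_eq
    X.isReducedSet hb hb'
  have hbij : Set.BijOn (basisReflection b i (X.coeff (posCone b) b i)) (Set.range b)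
      (base X.𝒜 X.R (X.nextChamber (posCone b) (b i).ker)) := by
    refine Classical.epsilon_spec (p := fun c => Set.BijOn (basisReflection b i c) (Set.range b)
      (base X.𝒜 X.R (X.nextChamber (posCone b) (b i).ker))) ⟨c, ?_⟩
    rw [hbase, ← hc, range_map_basisReflection]
    exact (basisReflection b i c).injective.injOn.bijOn_image
  have hrange := (range_map_basisReflection b i _).trans (hbij.image_eq.trans hbase)
  exact ⟨hb'.of_range_eq hrange.symm, hK.trans (posCone_eq_of_range_eq hrange.symm)⟩

section Paths

variable (K α)

theorem walk_append (a : List (Fin X.r)) (i : Fin X.r) :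
    X.walk K α (a ++ [i]) = X.step α (X.walk K α a) i :=
  List.foldl_concat _ _ _ _

theorem pathBasis_append (a : List (Fin X.r)) (i : Fin X.r) :
    X.pathBasis K α (a ++ [i]) = (X.pathBasis K α a).map (basisReflection (X.pathBasis K α a) i
      (X.coeff (X.walk K α a).1 (X.pathBasis K α a) i)) := by
  simp only [pathBasis, walk_append, step]
  exact Basis.eq_of_apply_eq fun j => by simp only [Basis.map_apply, LinearEquiv.trans_apply]

theorem pathBasis_append_apply (a : List (Fin X.r)) (i j : Fin X.r) :
    X.pathBasis K α (a ++ [i]) j =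
      X.pathBasis K α a j - X.pathMatrix K α a i j • X.pathBasis K α a i := by
  rw [pathBasis_append, Basis.map_apply, basisReflection_apply, pathMatrix]
  split_ifs with hj
  · rw [hj]
    module
  · rw [neg_smul, sub_neg_eq_add, natCast_zsmul]

/-- The ordered basis `π(a)(α_1), …, π(a)(α_r)` at the object represented by `a`. -/
def objectBasis (q : (X.cartanScheme K α).A) :
    Basis (X.cartanScheme K α).I ℝ (Dual ℝ (Fin X.r → ℝ)) :=
  X.pathBasis K α (Quotient.out (s := X.pathSetoid K α) q)

theorem objectBasis_mk (a : List (Fin X.r)) :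
    objectBasis K α (Quotient.mk (X.pathSetoid K α) a) = X.pathBasis K α a :=
  congrArg α.map (Quotient.mk_out (s := X.pathSetoid K α) a)

theorem objectBasis_injective : Function.Injective (objectBasis K α) := by
  intro q q' h
  rw [← Quotient.out_eq (s := X.pathSetoid K α) q, ← Quotient.out_eq (s := X.pathSetoid K α) q']
  refine Quotient.sound (LinearEquiv.toLinearMap_injective (α.ext fun j => ?_))
  exact congrArg (fun b : Basis (Fin X.r) ℝ (Dual ℝ (Fin X.r → ℝ)) => b j) h

instance : Nonempty (X.cartanScheme K α).A := ⟨Quotient.mk (X.pathSetoid K α) []⟩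

instance : Nonempty (X.cartanScheme K α).I := ⟨(⟨0, X.r_pos⟩ : Fin X.r)⟩

end Paths

theorem isRootBasis_pathBasis (hK : K ∈ chambers X.𝒜) (hα : X.IsOrdering K α)
    (a : List (Fin X.r)) :
    IsRootBasis X.R (X.pathBasis K α a) ∧ (X.walk K α a).1 = posCone (X.pathBasis K α a) := by
  induction a using List.reverseRecOn with
  | nil => exact isRootBasis_of_isOrdering hK hα
  | append_singleton a i ih =>
    obtain ⟨hb, hw⟩ := ih
    have hcoeff := isRootBasis_coeff hb i
    rw [← hw, ← pathBasis_append] at hcoeff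
    rwa [walk_append]

theorem realizes_cartanScheme (hK : K ∈ chambers X.𝒜) (hα : X.IsOrdering K α) :
    (X.cartanScheme K α).Realizes X.R (objectBasis K α) where
  reduced := X.isReducedSet
  rootBasis _ := (isRootBasis_pathBasis hK hα _).1
  diag _ _ := if_pos rfl
  step q i j :=
    (congrArg (fun b : Basis (Fin X.r) ℝ (Dual ℝ (Fin X.r → ℝ)) => b j)
      (objectBasis_mk K α (Quotient.out (s := X.pathSetoid K α) q ++ ([i] : List (Fin X.r))))).trans
      (pathBasis_append_apply K α _ i j)

theorem cartanScheme_ρ_mk (hK : K ∈ chambers X.𝒜) (hα : X.IsOrdering K α) (a : List (Fin X.r))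
    (i : Fin X.r) : (X.cartanScheme K α).ρ i (Quotient.mk (X.pathSetoid K α) a) =
      Quotient.mk (X.pathSetoid K α) (a ++ [i]) := by
  have h := realizes_cartanScheme hK hα
  refine objectBasis_injective K α ((h.isStep _ i).unique ?_ (h.rootBasis _) (h.rootBasis _))
  rw [objectBasis_mk, objectBasis_mk, pathBasis_append]
  exact isStep_basisReflection _ i _

theorem isConnected_cartanScheme (hK : K ∈ chambers X.𝒜) (hα : X.IsOrdering K α) :
    (X.cartanScheme K α).IsConnected := by
  refine CartanQuadruple.isConnected_of_forall_exists_isMorphism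
    (fun i a => objectBasis_injective K α ((realizes_cartanScheme hK hα).map_ρ_ρ a i))
    (Quotient.mk (X.pathSetoid K α) []) fun q => ?_
  obtain ⟨a, rfl⟩ := Quotient.exists_rep (s := X.pathSetoid K α) q
  induction a using List.reverseRecOn with
  | nil => exact ⟨_, .id⟩
  | append_singleton a i ih =>
    obtain ⟨w, hw⟩ := ih
    have hcomp := CartanQuadruple.IsMorphism.comp _ w i hw
    rw [cartanScheme_ρ_mk hK hα a i] at hcomp
    exact ⟨_, hcomp⟩

theorem isFiniteType_cartanScheme (hK : K ∈ chambers X.𝒜) (hα : X.IsOrdering K α) :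
    (X.cartanScheme K α).IsFiniteType :=
  (realizes_cartanScheme hK hα).isFiniteType (isConnected_cartanScheme hK hα)
    (objectBasis_injective K α)

theorem pathBasis_image_realRoots (hK : K ∈ chambers X.𝒜) (hα : X.IsOrdering K α)
    (a : List (Fin X.r)) :
    (fun x : Fin X.r → ℤ => ∑ j, x j • X.pathBasis K α a j) ''
      (X.cartanScheme K α).realRoots (Quotient.mk (X.pathSetoid K α) a) = X.R := by
  rw [← objectBasis_mk]
  exact (realizes_cartanScheme hK hα).image_realRoots (isConnected_cartanScheme hK hα) _

theorem cartanScheme_equivalent_iff {Y : CrystallographicArrangement} {K' : Set (Fin Y.r → ℝ)}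
    {α' : Basis (Fin Y.r) ℝ (Dual ℝ (Fin Y.r → ℝ))} (hK : K ∈ chambers X.𝒜)
    (hα : X.IsOrdering K α) (hK' : K' ∈ chambers Y.𝒜) (hα' : Y.IsOrdering K' α') :
    (X.cartanScheme K α).Equivalent (Y.cartanScheme K' α') ↔ X.Equivalent Y := by
  have h := realizes_cartanScheme hK hα
  have h' := realizes_cartanScheme hK' hα'
  have hc := isConnected_cartanScheme hK hα
  have hc' := isConnected_cartanScheme hK' hα'
  refine ⟨h.exists_linearEquiv hc h' hc', ?_⟩
  rintro ⟨ψ, hψ⟩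
  exact h.equivalent hc (objectBasis_injective K α) h' hc' (objectBasis_injective K' α') hψ

/-- The arrangement of the kernels of the elements of a reduced set `R`, all of whose chambers are
cut out by root bases of `R`. -/
def ofRootBases {r : ℕ} (hr : 0 < r) {R : Set (Dual ℝ (Fin r → ℝ))} (hR : IsReducedSet ℝ R)
    (hb : ∀ K ∈ chambers (hyperplanes R),
      ∃ b : Basis (Fin r) ℝ (Dual ℝ (Fin r → ℝ)), IsRootBasis R b ∧ K = posCone b) :
    CrystallographicArrangement where
  r := r
  r_pos := hr
  𝒜 := hyperplanes R
  R := R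
  simplicial :=
    { finite := (hR.finite.image LinearMap.ker).subset fun _ ⟨x, hx, h⟩ => ⟨x, hx, h.symm⟩
      hyperplane := by
        rintro _ ⟨x, hx, rfl⟩
        exact finrank_ker_add_one (hR.ne_zero hx)
      cone := fun K hK => isOpenSimplicialCone_iff.2 ((hb K hK).imp fun _ h => h.2) }
  finite_R := hR.finite
  𝒜_eq := rfl
  reduced x hx := by
    ext y
    constructor
    · rintro ⟨hy, t, rfl⟩
      rcases hR.reduced x hx t hy with rfl | rfl
      · exact Or.inl (one_smul ℝ x)
      · exact Or.inr (neg_one_smul ℝ x)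
    · rintro (rfl | rfl)
      · exact ⟨hx, 1, (one_smul ℝ _).symm⟩
      · exact ⟨hR.neg_mem x hx, -1, (neg_one_smul ℝ _).symm⟩
  integral K hK x hx := by
    obtain ⟨b, hb, rfl⟩ := hb K hK
    rw [Arrangement.base_posCone hR hb.toIsSimpleSystem]
    exact (b.mem_span_iff_repr_mem ℤ x).2 fun i => (hb.integral x hx i).imp fun n hn => hn.symm

theorem exists_isRootBasis_of_realizes {S : CartanQuadruple.{u, v}} [Nonempty S.A] {r : ℕ}
    {R : Set (Dual ℝ (Fin r → ℝ))} {β : S.A → Basis S.I ℝ (Dual ℝ (Fin r → ℝ))}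
    (h : S.Realizes R β) (e : S.I ≃ Fin r) {K : Set (Fin r → ℝ)}
    (hK : K ∈ chambers (hyperplanes R)) :
    ∃ b : Basis (Fin r) ℝ (Dual ℝ (Fin r → ℝ)), IsRootBasis R b ∧ K = posCone b := by
  obtain ⟨v, hv⟩ := nonempty_of_mem_chambers hK
  obtain ⟨a, ha⟩ := h.exists_forall_pos (f := Dual.eval ℝ _ v)
    (mem_complement_hyperplanes.1 (subset_complement hK hv))
  have hb := (h.rootBasis a).reindex e
  refine ⟨(β a).reindex e, hb, chambers_eq_of_mem hK
    (Arrangement.posCone_mem_chambers h.reduced hb.toIsSimpleSystem) hv fun i => ?_⟩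
  rw [Basis.reindex_apply]
  exact ha _

theorem exists_cartanScheme_equivalent {S : CartanQuadruple.{u, v}} (hS : S.IsFiniteType) :
    ∃ X : CrystallographicArrangement, ∃ K ∈ chambers X.𝒜,
      ∃ α, X.IsOrdering K α ∧ (X.cartanScheme K α).Equivalent S := by
  have := hS.scheme.nonempty_I
  have := hS.scheme.nonempty_A
  let e := Fintype.equivFin S.I
  obtain ⟨R, β, h⟩ := hS.exists_realizes ((Pi.basisFun ℝ _).dualBasis.reindex e.symm)
  let X := ofRootBases Fintype.card_pos h.reduced fun K => exists_isRootBasis_of_realizes h e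
  obtain ⟨K, hK⟩ := X.nonempty_chambers
  obtain ⟨α, hα⟩ := exists_isOrdering hK
  exact ⟨X, K, hK, α, hα, (realizes_cartanScheme hK hα).equivalent
    (isConnected_cartanScheme hK hα) (objectBasis_injective K α) h hS.connected (h.injective hS)
    (ψ := LinearEquiv.refl ℝ _) (Set.image_id _)⟩

/-! ### The map on equivalence classes -/

/-- The Cartan scheme of a crystallographic arrangement at an arbitrarily chosen chamber `K` and
ordering of `B^K`. -/
def toFiniteTypeScheme (X : CrystallographicArrangement) : FiniteTypeScheme.{0, 0} :=
  let hK := X.nonempty_chambers.some_mem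
  ⟨X.cartanScheme _ (exists_isOrdering hK).choose,
    isFiniteType_cartanScheme hK (exists_isOrdering hK).choose_spec⟩

theorem toFiniteTypeScheme_equivalent_iff {X Y : CrystallographicArrangement} :
    X.toFiniteTypeScheme ≈ Y.toFiniteTypeScheme ↔ X ≈ Y :=
  cartanScheme_equivalent_iff X.nonempty_chambers.some_mem (Exists.choose_spec _)
    Y.nonempty_chambers.some_mem (Exists.choose_spec _)

/-- The map `Λ` from equivalence classes of crystallographic arrangements to equivalence classes of
Cartan schemes. -/
def schemeClass :
    Quotient CrystallographicArrangement.setoid → Quotient FiniteTypeScheme.setoid.{0, 0} :=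
  Quotient.map toFiniteTypeScheme fun _ _ => toFiniteTypeScheme_equivalent_iff.2

theorem schemeClass_mk (hK : K ∈ chambers X.𝒜) (hα : X.IsOrdering K α) :
    schemeClass (Quotient.mk _ X) =
      Quotient.mk _ ⟨X.cartanScheme K α, isFiniteType_cartanScheme hK hα⟩ :=
  Quotient.sound <| (cartanScheme_equivalent_iff X.nonempty_chambers.some_mem
    (Exists.choose_spec _) hK hα).2 (setoid.refl X)

theorem schemeClass_injective : Function.Injective schemeClass := by
  rintro ⟨X⟩ ⟨Y⟩ h
  exact Quotient.sound (toFiniteTypeScheme_equivalent_iff.1 (Quotient.exact h))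

theorem schemeClass_surjective : Function.Surjective schemeClass := by
  rintro ⟨S, hS⟩
  obtain ⟨X, K, hK, α, hα, h⟩ := exists_cartanScheme_equivalent hS
  exact ⟨Quotient.mk _ X, (schemeClass_mk hK hα).trans (Quotient.sound h)⟩

end CrystallographicArrangement

end

theorem theorem4p4 :
    -- every arrangement has a chamber, and every chamber gives an (orderable) basis `B^K`
    (∀ X : CrystallographicArrangement,
      (Arrangement.chambers X.𝒜).Nonempty ∧
      ∀ K ∈ Arrangement.chambers X.𝒜, ∃ α, X.IsOrdering K α) ∧
    -- the map `Λ` is well defined and bijective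
    (∃ Λ : Quotient CrystallographicArrangement.setoid →
        Quotient FiniteTypeScheme.setoid.{0, 0},
      (∀ X : CrystallographicArrangement, ∀ K ∈ Arrangement.chambers X.𝒜,
        ∀ α, X.IsOrdering K α →
          ∃ h : (X.cartanScheme K α).IsFiniteType,
            Λ (Quotient.mk _ X) = Quotient.mk _ ⟨X.cartanScheme K α, h⟩) ∧
      Function.Bijective Λ) ∧
    -- `R` is the set of real roots: at each object, in the coordinates of the basis there
    (∀ X : CrystallographicArrangement, ∀ K ∈ Arrangement.chambers X.𝒜,
      ∀ α, X.IsOrdering K α → ∀ a : List (Fin X.r),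
        X.R = (fun x : Fin X.r → ℤ => ∑ j, x j • X.pathBasis K α a j) ''
          (X.cartanScheme K α).realRoots (Quotient.mk (X.pathSetoid K α) a)) ∧
    -- surjectivity for Cartan schemes of arbitrary size
    (∀ S : CartanQuadruple.{u, v}, S.IsFiniteType →
      ∃ X : CrystallographicArrangement, ∃ K ∈ Arrangement.chambers X.𝒜,
        ∃ α, X.IsOrdering K α ∧ (X.cartanScheme K α).Equivalent S) :=
  open CrystallographicArrangement in
  ⟨fun X => ⟨X.nonempty_chambers, fun _ => exists_isOrdering⟩,
    ⟨schemeClass, fun _ _ hK _ hα => ⟨isFiniteType_cartanScheme hK hα, schemeClass_mk hK hα⟩,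
      schemeClass_injective, schemeClass_surjective⟩,
    fun _ _ hK _ hα a => (pathBasis_image_realRoots hK hα a).symm,
    fun _ => exists_cartanScheme_equivalent⟩
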